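/- Let $X=\{X_t\}_{t\ge 0}$ and $B=\{B_t\}_{t\ge 0}$ be two independent standard real Brownian motions started at $0$, defined on the same probability space, and let $G\sim\mathcal N(0,1)$. For $n\ge 0$ put $X^{(n)}_t=2^{n/4}X_{t2^{-n/2}}$, $t\ge 0$. Let $\mathsf P:\mathbb R\to\mathbb R$ be a polynomial of centered Hermite rank $\ge 2$, that is, $E[G\,\mathsf P(G)]=0$. Let $\alpha,\beta,\gamma\in\mathbb R$, and let $\phi(j)=\alpha$ for $j$ even and $\phi(j)=\beta$ for $j$ odd. Let $f:\mathbb R\to\mathbb R$ be of class $C^2$ with $f'$ and $f''$ bounded. For $t\ge 0$ set $$J^{(n)}_t(f)=2^{-n/4}\,\frac12\sum_{j=1}^{\lfloor 2^{n/2}t\rfloor}\bigl(f(X_{(j-1)2^{-n/2}})+f(X_{j2^{-n/2}})\bigr)\Bigl[\phi(j)\bigl\{\mathsf P\bigl(X^{(n)}_j-X^{(n)}_{j-1}\bigr)-E[\mathsf P(G)]\bigr\}+\gamma(-1)^j\bigl(X^{(n)}_j-X^{(n)}_{j-1}\bigr)\Bigr].$$ Then the It\^o integral $\int_0^t f(X_s)\,dB_s$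 is well defined for every $t\ge 0$ (as an $L^2$ limit of integrals of simple processes adapted to the filtration generated by $(X,B)$), and, as $n\to\infty$, the two-dimensional process $\{J^{(n)}_t(f),\,X_t\}_{t\ge 0}$ converges in the sense of finite dimensional distributions to $$\Bigl\{\sqrt{\gamma^2+\tfrac{\alpha^2+\beta^2}{2}\,\mathrm{Var}\bigl(\mathsf P(G)\bigr)}\;\int_0^t f(X_s)\,dB_s,\;X_t\Bigr\}_{t\ge 0}.$$ -/

import Mathlib

open MeasureTheory ProbabilityTheory Filter Topology
open scoped NNReal ENNReal

noncomputable section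

namespace WeightedVariation

/-- A polynomial `p` has centered Hermite rank at least two when `E[G p(G)] = 0`,
with `G` a standard Gaussian random variable. -/
def HasCenteredHermiteRankGeTwo (p : Polynomial ℝ) : Prop :=
  ∫ x, x * p.eval x ∂(gaussianReal 0 1) = 0

/-- `E[p(G)]` for a standard Gaussian `G`. -/
def gaussianMean (p : Polynomial ℝ) : ℝ :=
  ∫ x, p.eval x ∂(gaussianReal 0 1)

/-- `Var(p(G))` for a standard Gaussian `G`. -/
def gaussianVar (p : Polynomial ℝ) : ℝ :=
  Var[fun x => p.eval x; gaussianReal 0 1]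

/-- The alternating function `φ`: `φ j` is `α` for `j` even and `β` for `j` odd. -/
def alternating (α β : ℝ) (j : ℕ) : ℝ :=
  if Even j then α else β

variable {Ω : Type*} {mΩ : MeasurableSpace Ω}

/-- The rescaled process `X⁽ⁿ⁾_t = 2^{n/4} X_{t 2^{-n/2}}`. -/
def rescaled (X : ℝ≥0 → Ω → ℝ) (n : ℕ) (t : ℝ≥0) (ω : Ω) : ℝ :=
  (2 : ℝ) ^ ((n : ℝ) / 4) * X (t * (2 : ℝ≥0) ^ (-(n : ℝ) / 2)) ω

/-- The increment `X⁽ⁿ⁾_j - X⁽ⁿ⁾_{j-1}` (used for `j ≥ 1`). -/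
def increment (X : ℝ≥0 → Ω → ℝ) (n j : ℕ) (ω : Ω) : ℝ :=
  rescaled X n (j : ℝ≥0) ω - rescaled X n ((j - 1 : ℕ) : ℝ≥0) ω

/-- The weighted sums `J_t⁽ⁿ⁾(f)`. -/
def weightedSum (X : ℝ≥0 → Ω → ℝ) (p : Polynomial ℝ) (α β γ : ℝ) (f : ℝ → ℝ)
    (n : ℕ) (t : ℝ≥0) (ω : Ω) : ℝ :=
  (2 : ℝ) ^ (-(n : ℝ) / 4) * (1 / 2) *
    ∑ j ∈ Finset.Icc 1 ⌊(2 : ℝ) ^ ((n : ℝ) / 2) * (t : ℝ)⌋₊,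
      (f (X (((j - 1 : ℕ) : ℝ≥0) * (2 : ℝ≥0) ^ (-(n : ℝ) / 2)) ω)
          + f (X ((j : ℝ≥0) * (2 : ℝ≥0) ^ (-(n : ℝ) / 2)) ω))
        * (alternating α β j * (p.eval (increment X n j ω) - gaussianMean p)
          + γ * (-1) ^ j * increment X n j ω)

/-- The filtration generated jointly by two real processes. -/
def jointFiltration (X B : ℝ≥0 → Ω → ℝ) (hX : ∀ t, Measurable (X t))
    (hB : ∀ t, Measurable (B t)) : Filtration ℝ≥0 mΩ :=
  Filtration.natural (fun t ω => (X t ω, B t ω))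
    (fun t => ((hX t).prodMk (hB t)).stronglyMeasurable)

/-- Simple adapted processes `∑_{i < N} ξ_i 1_{(t_i, t_{i+1}]}`, where `ξ_i` is square integrable
and measurable with respect to the filtration at time `t_i`. -/
structure SimpleProcess (F : Filtration ℝ≥0 mΩ) (P : Measure Ω) where
  /-- the number of steps -/
  N : ℕ
  /-- the partition times -/
  time : ℕ → ℝ≥0
  monotone_time : Monotone time
  /-- the values -/
  ξ : ℕ → Ω → ℝ
  measurable_ξ : ∀ i, Measurable[F (time i)] (ξ i)
  memLp_ξ : ∀ i, MemLp (ξ i) 2 P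

/-- The value at time `s` of a simple process. -/
def SimpleProcess.eval {F : Filtration ℝ≥0 mΩ} {P : Measure Ω} (H : SimpleProcess F P)
    (s : ℝ≥0) (ω : Ω) : ℝ :=
  ∑ i ∈ Finset.range H.N,
    (Set.Ioc (H.time i) (H.time (i + 1))).indicator (fun _ => H.ξ i ω) s

/-- The elementary stochastic integral over `[0, t]` of a simple process with respect to `B`. -/
def SimpleProcess.integral {F : Filtration ℝ≥0 mΩ} {P : Measure Ω} (H : SimpleProcess F P)
    (B : ℝ≥0 → Ω → ℝ) (t : ℝ≥0) (ω : Ω) : ℝ :=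
  ∑ i ∈ Finset.range H.N,
    H.ξ i ω * (B (min (H.time (i + 1)) t) ω - B (min (H.time i) t) ω)

/-- `J` is (a version of) the Itô integral `∫₀ᵗ H_s dB_s` of a square integrable process `H`
adapted to `F`, for an `F`-Brownian motion `B`: the `L²` limit of the elementary integrals of simple
adapted processes that approximate `H` in `L²(P ⊗ ds)` on `[0, t]`. The random variable `J` is
determined up to almost sure equality. -/
def IsItoIntegral (F : Filtration ℝ≥0 mΩ) (P : Measure Ω) (B H : ℝ≥0 → Ω → ℝ)
    (t : ℝ≥0) (J : Ω → ℝ) : Prop :=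
  AEStronglyMeasurable J P ∧
  ∃ φ : ℕ → SimpleProcess F P,
    Tendsto (fun k => ∫⁻ ω, (∫⁻ s in Set.Icc (0 : ℝ) t,
      ‖(φ k).eval s.toNNReal ω - H s.toNNReal ω‖ₑ ^ 2) ∂P) atTop (𝓝 0) ∧
    Tendsto (fun k => eLpNorm (fun ω => (φ k).integral B t ω - J ω) 2 P) atTop (𝓝 0)

/-- Convergence in the sense of finite dimensional distributions of processes `Y n`, indexed by
`[0, ∞)` and with values in `ℝ²`, to the process `Z`. -/
def TendstoFDD (P : Measure Ω) [IsProbabilityMeasure P]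
    (Y : ℕ → ℝ≥0 → Ω → ℝ × ℝ) (Z : ℝ≥0 → Ω → ℝ × ℝ) : Prop :=
  ∀ I : Finset ℝ≥0,
    TendstoInDistribution (fun (n : ℕ) (ω : Ω) (t : I) => Y n t ω) atTop
      (fun (ω : Ω) (t : I) => Z t ω) (fun _ => P) P

end WeightedVariation

end

namespace WeightedVariation

section ConvergingTogether

variable {Ω : Type*} {mΩ : MeasurableSpace Ω} {P : Measure Ω} [IsProbabilityMeasure P]
  {E : Type*} [NormedAddCommGroup E] [MeasurableSpace E] [BorelSpace E]
  [SecondCountableTopology E]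

/-- A bounded Lipschitz function has nearby expectations at random variables nearby in `L¹`. -/
lemma abs_integral_map_sub_le {F : E → ℝ} {M : ℝ} (hM : ∀ x y, dist (F x) (F y) ≤ M)
    {K : ℝ≥0} (hK : LipschitzWith K F) {Y Z : Ω → E} (hY : AEMeasurable Y P)
    (hZ : AEMeasurable Z P) {c : ℝ} (hc : 0 ≤ c)
    (h : ∫⁻ ω, ‖Y ω - Z ω‖ₑ ∂P ≤ ENNReal.ofReal c) :
    |∫ x, F x ∂(P.map Y) - ∫ x, F x ∂(P.map Z)| ≤ K * c := by
  have hF : Continuous F := hK.continuous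
  have hint : ∀ {W : Ω → E}, AEMeasurable W P → Integrable (fun ω => F (W ω)) P := by
    intro W hW
    refine Integrable.of_bound (by fun_prop) (‖F 0‖ + M) (ae_of_all _ fun a ↦ ?_)
    rw [← sub_le_iff_le_add']
    exact (abs_sub_abs_le_abs_sub (F (W a)) (F 0)).trans (hM _ _)
  rw [integral_map (by fun_prop) (by fun_prop), integral_map (by fun_prop) (by fun_prop),
    ← integral_sub (hint hY) (hint hZ), ← Real.norm_eq_abs]
  have hlin : ∫⁻ ω, ‖F (Y ω) - F (Z ω)‖ₑ ∂P ≤ ENNReal.ofReal (K * c) := by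
    calc ∫⁻ ω, ‖F (Y ω) - F (Z ω)‖ₑ ∂P ≤ ∫⁻ ω, K * ‖Y ω - Z ω‖ₑ ∂P := by
          refine lintegral_mono fun ω => ?_
          have := hK (Y ω) (Z ω)
          rwa [edist_eq_enorm_sub, edist_eq_enorm_sub] at this
      _ = K * ∫⁻ ω, ‖Y ω - Z ω‖ₑ ∂P := by rw [lintegral_const_mul' _ _ (by simp)]
      _ ≤ K * ENNReal.ofReal c := by gcongr
      _ = _ := by rw [ENNReal.ofReal_mul (by positivity), ENNReal.ofReal_coe_nnreal]
  refine (norm_integral_le_lintegral_norm _).trans ?_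
  refine ENNReal.toReal_le_of_le_ofReal (by positivity) ?_
  simpa only [ofReal_norm] using hlin

/-- Convergence in distribution along approximations that are uniformly good in `L¹`. -/
lemma tendstoInDistribution_of_forall_approx {Y : ℕ → Ω → E} {Z : Ω → E}
    (hY : ∀ n, AEMeasurable (Y n) P) (hZ : AEMeasurable Z P)
    (h : ∀ ε > 0, ∃ (Y' : ℕ → Ω → E) (Z' : Ω → E),
      TendstoInDistribution Y' atTop Z' (fun _ => P) P ∧
      (∀ᶠ n in atTop, ∫⁻ ω, ‖Y n ω - Y' n ω‖ₑ ∂P ≤ ENNReal.ofReal ε) ∧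
      ∫⁻ ω, ‖Z' ω - Z ω‖ₑ ∂P ≤ ENNReal.ofReal ε) :
    TendstoInDistribution Y atTop Z (fun _ => P) P := by
  refine ⟨hY, hZ, ?_⟩
  refine tendsto_iff_forall_lipschitz_integral_tendsto.2 ?_
  rintro F ⟨M, hM⟩ ⟨K, hK⟩
  rw [Metric.tendsto_atTop']
  intro ε hε
  obtain ⟨Y', Z', hD, h1, h2⟩ := h (ε / (3 * (K + 1))) (by positivity)
  have hD' := tendsto_iff_forall_lipschitz_integral_tendsto.1 hD.tendsto
  have h3 := Metric.tendsto_atTop'.1 (hD' F ⟨M, hM⟩ ⟨K, hK⟩) (ε / 3) (by positivity)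
  have hKe : (K : ℝ) * (ε / (3 * (K + 1))) < ε / 3 := by
    rw [mul_div_assoc', div_lt_div_iff₀ (by positivity) (by positivity)]
    nlinarith [K.coe_nonneg]
  obtain ⟨n₀, hn₀⟩ := h3
  obtain ⟨n₁, hn₁⟩ := eventually_atTop.1 h1
  refine ⟨max n₀ n₁, fun n hn => ?_⟩
  have e1 := abs_integral_map_sub_le hM hK (hY n) (hD.forall_aemeasurable n) (by positivity)
    (hn₁ n ((le_max_right _ _).trans hn.le))
  have e2 := hn₀ n ((le_max_left _ _).trans_lt hn)
  have e3 := abs_integral_map_sub_le hM hK hD.aemeasurable_limit hZ (by positivity) h2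
  rw [Real.dist_eq] at e2 ⊢
  simp only [ProbabilityMeasure.coe_mk] at e2 ⊢
  rw [abs_lt] at e2 ⊢
  rw [abs_le] at e1 e3
  constructor <;> linarith

end ConvergingTogether

section Norms

variable {Ω : Type*} {mΩ : MeasurableSpace Ω} {P : Measure Ω}

lemma eLpNorm_two_le_of_integral_sq_le {Y : Ω → ℝ} (hY : MemLp Y 2 P) {c : ℝ}
    (h : ∫ ω, Y ω ^ 2 ∂P ≤ c) : eLpNorm Y 2 P ≤ ENNReal.ofReal (√c) := by
  rw [hY.eLpNorm_eq_integral_rpow_norm (by simp) (by simp)]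
  refine ENNReal.ofReal_le_ofReal ?_
  simp only [ENNReal.toReal_ofNat, Real.rpow_two, Real.norm_eq_abs, sq_abs]
  rw [Real.sqrt_eq_rpow, one_div]
  exact Real.rpow_le_rpow (integral_nonneg fun _ => sq_nonneg _) h (by norm_num)

lemma eLpNorm_one_le_of_integral_sq_le [IsProbabilityMeasure P] {Y : Ω → ℝ} (hY : MemLp Y 2 P)
    {c : ℝ} (h : ∫ ω, Y ω ^ 2 ∂P ≤ c) : eLpNorm Y 1 P ≤ ENNReal.ofReal (√c) :=
  (eLpNorm_le_eLpNorm_of_exponent_le (by norm_num) hY.1).trans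
    (eLpNorm_two_le_of_integral_sq_le hY h)

lemma eLpNorm_one_le_of_integral_abs_le {Y : Ω → ℝ} (hY : Integrable Y P) {c : ℝ}
    (h : ∫ ω, |Y ω| ∂P ≤ c) : eLpNorm Y 1 P ≤ ENNReal.ofReal c := by
  rw [eLpNorm_one_eq_lintegral_enorm, ← ofReal_integral_norm_eq_lintegral_enorm hY]
  exact ENNReal.ofReal_le_ofReal h

end Norms

section CharFun

open Complex

lemma tendsto_pow_exp_of_tendsto_mul {N : ℕ → ℕ} {z : ℕ → ℂ} {w : ℂ}
    (hz : Tendsto z atTop (𝓝 0)) (h : Tendsto (fun n => (N n : ℂ) * z n) atTop (𝓝 w)) :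
    Tendsto (fun n => (1 + z n) ^ N n) atTop (𝓝 (exp w)) := by
  have hz' : ∀ᶠ n in atTop, ‖z n‖ < 1 / 2 := by
    have := hz.norm
    rw [norm_zero] at this
    exact this.eventually_lt_const (by norm_num)
  have hlog : Tendsto (fun n => (N n : ℂ) * (log (1 + z n) - z n)) atTop (𝓝 0) := by
    have hlim : Tendsto (fun n => ‖(N n : ℂ) * z n‖ * ‖z n‖) atTop (𝓝 0) := by
      simpa using h.norm.mul hz.norm
    refine squeeze_zero_norm' ?_ hlim
    filter_upwards [hz'] with n hn
    have h1 := norm_log_one_add_sub_self_le (z := z n) (by linarith)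
    have h2 : (1 - ‖z n‖)⁻¹ ≤ 2 := by
      rw [inv_le_comm₀ (by linarith) (by norm_num)]; linarith
    rw [norm_mul, norm_mul, mul_assoc]
    gcongr
    refine h1.trans ?_
    nlinarith [sq_nonneg ‖z n‖]
  have hsum := (continuous_exp.tendsto _).comp (hlog.add h)
  rw [zero_add] at hsum
  refine hsum.congr' ?_
  filter_upwards [hz'] with n hn
  have hne : 1 + z n ≠ 0 := by
    intro h0
    have : z n = -1 := by linear_combination h0
    rw [this] at hn
    norm_num at hn
  simp only [Function.comp]
  rw [← mul_add, sub_add_cancel, exp_nat_mul, exp_log hne]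

/-- Powers of the characteristic function of a centered square integrable variable. -/
lemma tendsto_charFun_pow {Ω : Type*} {mΩ : MeasurableSpace Ω} {P : Measure Ω}
    [IsProbabilityMeasure P] {Y : Ω → ℝ} (hY : MemLp Y 2 P) (h0 : ∫ ω, Y ω ∂P = 0) {s : ℝ}
    (hs : ∫ ω, Y ω ^ 2 ∂P = s) {N : ℕ → ℕ} {r : ℕ → ℝ} (hr : Tendsto r atTop (𝓝 0)) {v : ℝ}
    (h : Tendsto (fun n => (N n : ℝ) * r n ^ 2) atTop (𝓝 v)) :
    Tendsto (fun n => charFun (P.map Y) (r n) ^ N n) atTop (𝓝 (exp (-(s * v / 2 : ℝ)))) := by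
  have hYm : AEMeasurable Y P := hY.1.aemeasurable
  have : IsProbabilityMeasure (P.map Y) := Measure.isProbabilityMeasure_map hYm
  have hid : MemLp id 2 (P.map Y) := by
    rw [memLp_map_measure_iff (by fun_prop) hYm]; exact hY
  have htay : (fun t => charFun (P.map Y) t - (1 - (s : ℂ) * t ^ 2 / 2)) =o[𝓝 0]
      fun t : ℝ => t ^ 2 := by
    have h1 := taylor_isLittleO_univ (x₀ := 0) (contDiff_charFun (n := 2) hid)
    simp_rw [sub_zero] at h1
    refine h1.congr_left fun t => ?_
    rw [taylorWithinEval_charFun_two_zero hYm hid]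
    simp only [Pi.pow_apply, h0, hs]
    simp
  have hr2 : Tendsto (fun n => (r n : ℂ) ^ 2) atTop (𝓝 0) := by
    have h2 := ((continuous_ofReal.tendsto 0).comp hr).pow 2
    simpa using h2
  have herr := htay.comp_tendsto hr
  have hN : Tendsto (fun n => (N n : ℂ) * (charFun (P.map Y) (r n) - (1 - (s : ℂ) * r n ^ 2 / 2)))
      atTop (𝓝 0) := by
    have hO : (fun n => (N n : ℂ) *
        (charFun (P.map Y) (r n) - (1 - (s : ℂ) * r n ^ 2 / 2))) =o[atTop]
        fun n => (N n : ℝ) * r n ^ 2 := by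
      refine Asymptotics.IsBigO.mul_isLittleO ?_ herr
      exact Asymptotics.IsBigO.of_norm_le fun n => by simp
    exact (hO.trans_isBigO (h.isBigO_one ℝ)).tendsto_zero_of_tendsto tendsto_const_nhds
  have hNr : Tendsto (fun n => (N n : ℂ) * (r n : ℂ) ^ 2) atTop (𝓝 v) := by
    have := (continuous_ofReal.tendsto v).comp h
    refine this.congr fun n => ?_
    simp
  have key := tendsto_pow_exp_of_tendsto_mul (N := N)
    (z := fun n => charFun (P.map Y) (r n) - 1) (w := -(s * v / 2 : ℝ)) ?_ ?_
  · simpa using key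
  · have hc := (continuous_charFun (μ := P.map Y)).tendsto 0 |>.comp hr
    simp only [charFun_zero, probReal_univ] at hc
    simpa [Function.comp_def] using hc.sub_const 1
  · have := hN.add (hNr.const_mul (-(s : ℂ) / 2))
    refine (this.congr fun n => ?_).trans (le_of_eq ?_)
    · ring
    · congr 1; push_cast; ring

end CharFun

end WeightedVariation

namespace WeightedVariation

variable {Ω : Type*} {mΩ : MeasurableSpace Ω} {P : Measure Ω}

section Independence

lemma indepFun_of_measurable_of_indep {α β : Type*} [MeasurableSpace α] [MeasurableSpace β]
    {m₁ m₂ : MeasurableSpace Ω} (h : Indep m₁ m₂ P) {W : Ω → α} {Z : Ω → β}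
    (hW : Measurable[m₁] W) (hZ : Measurable[m₂] Z) : IndepFun W Z P :=
  indep_of_indep_of_le_left (indep_of_indep_of_le_right h hZ.comap_le) hW.comap_le

lemma indepFun_prodMk_of_indepFun [IsProbabilityMeasure P] {α β γ : Type*} [MeasurableSpace α]
    [MeasurableSpace β] [MeasurableSpace γ] {U : Ω → α} {V : Ω → β} {W : Ω → γ}
    (hU : Measurable U) (hV : Measurable V) (hW : Measurable W)
    (h : IndepFun (fun ω => (U ω, V ω)) W P) (hUV : IndepFun U V P) :
    IndepFun U (fun ω => (V ω, W ω)) P := by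
  have : IsProbabilityMeasure (P.map U) := Measure.isProbabilityMeasure_map hU.aemeasurable
  have : IsProbabilityMeasure (P.map V) := Measure.isProbabilityMeasure_map hV.aemeasurable
  have : IsProbabilityMeasure (P.map W) := Measure.isProbabilityMeasure_map hW.aemeasurable
  have hVW : IndepFun V W P := h.comp measurable_snd measurable_id
  rw [indepFun_iff_map_prod_eq_prod_map_map (by fun_prop) (by fun_prop)] at h hUV hVW ⊢
  rw [hVW, ← Measure.prodAssoc_prod, ← hUV, ← h, Measure.map_map (by fun_prop) (by fun_prop)]
  rfl

lemma memLp_mul_of_indepFun {W Z : Ω → ℝ} (h : IndepFun W Z P)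
    (hW : MemLp W 2 P) (hZ : MemLp Z 2 P) : MemLp (fun ω => W ω * Z ω) 2 P := by
  refine (memLp_two_iff_integrable_sq (hW.1.mul hZ.1)).2 ?_
  have := (h.comp (φ := fun x : ℝ => x ^ 2) (ψ := fun x : ℝ => x ^ 2) (by fun_prop)
    (by fun_prop)).integrable_mul hW.integrable_sq hZ.integrable_sq
  refine this.congr (ae_of_all _ fun ω => ?_)
  simp [mul_pow]

end Independence

section BrownianIncrements

variable {X B : ℝ≥0 → Ω → ℝ}

lemma memLp_increment (hB : IsBrownianReal B P) (s t : ℝ≥0) :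
    MemLp (fun ω => B t ω - B s ω) 2 P :=
  (hB.isGaussianProcess.hasGaussianLaw_sub).memLp_two

lemma integral_increment (hB : IsBrownianReal B P) (s t : ℝ≥0) :
    ∫ ω, (B t ω - B s ω) ∂P = 0 := by
  rw [integral_sub (hB.integrable_eval _) (hB.integrable_eval _), hB.integral_eval,
    hB.integral_eval, sub_zero]

lemma integral_increment_mul_increment (hB : IsBrownianReal B P) {c b d : ℝ≥0} (hb : c ≤ b)
    (hd : c ≤ d) :
    ∫ ω, (B b ω - B c ω) * (B d ω - B c ω) ∂P = min (b : ℝ) d - c := by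
  have : IsProbabilityMeasure P := hB.isGaussianProcess.isProbabilityMeasure
  have h := covariance_eq_sub (memLp_increment hB c b) (memLp_increment hB c d)
  rw [integral_increment hB, integral_increment hB, zero_mul, sub_zero] at h
  have h2 : ∀ t, MemLp (B t) 2 P := fun t => (hB.isGaussianProcess.hasGaussianLaw_eval t).memLp_two
  rw [covariance_fun_sub_left (h2 _) (h2 _) (memLp_increment hB c d),
    covariance_fun_sub_right (h2 _) (h2 _) (h2 _), covariance_fun_sub_right (h2 _) (h2 _) (h2 _),
    hB.covariance_eval, hB.covariance_eval, hB.covariance_eval, hB.covariance_eval,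
    min_eq_right hb, min_eq_left hd, min_self] at h
  simp only [Pi.mul_apply] at h
  rw [← h]
  push_cast
  ring

lemma integral_increment_sq (hB : IsBrownianReal B P) (s t : ℝ≥0) :
    ∫ ω, (B t ω - B s ω) ^ 2 ∂P = |(t : ℝ) - s| := by
  rcases le_total s t with h | h
  · have := integral_increment_mul_increment hB h h
    simp_rw [← sq] at this
    rw [this, min_self, abs_of_nonneg]
    exact sub_nonneg.2 (by exact_mod_cast h)
  · have := integral_increment_mul_increment hB h h
    simp_rw [← sq] at this
    rw [abs_sub_comm, abs_of_nonneg (sub_nonneg.2 (by exact_mod_cast h))]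
    rw [min_self] at this
    rw [← this]
    congr with ω
    ring

variable [IsProbabilityMeasure P]

lemma indep_jointFiltration (hXm : ∀ t, Measurable (X t)) (hBm : ∀ t, Measurable (B t))
    (hB : IsBrownianReal B P) (hXB : IndepFun (fun ω t => X t ω) (fun ω t => B t ω) P)
    (s : ℝ≥0) :
    Indep (jointFiltration X B hXm hBm s)
      (MeasurableSpace.comap (fun ω (u : ℝ≥0) => B (s + u) ω - B s ω) inferInstance) P := by
  have h1 : IndepFun (fun ω (u : ℝ≥0) => B (s + u) ω - B s ω)
      (fun ω => ((fun (r : Set.Iic s) => B r ω), (fun r => X r ω))) P := by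
    refine indepFun_prodMk_of_indepFun (by fun_prop) (by fun_prop) (by fun_prop) ?_
      (hB.indepFun_shift s)
    exact (hXB.symm).comp (φ := fun b : ℝ≥0 → ℝ =>
      ((fun u : ℝ≥0 => b (s + u) - b s), (fun r : Set.Iic s => b r))) (by fun_prop) measurable_id
  refine indep_of_indep_of_le_left h1.symm ?_
  refine iSup₂_le fun r hr => ?_
  rw [← measurable_iff_comap_le]
  have hg := comap_measurable (m := inferInstance)
    (fun ω => ((fun (r : Set.Iic s) => B r ω), (fun r => X r ω)))
  exact (((measurable_pi_apply r).comp (measurable_snd)).prodMk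
    ((measurable_pi_apply (⟨r, hr⟩ : Set.Iic s)).comp measurable_fst)).comp hg

variable (hXm : ∀ t, Measurable (X t)) (hBm : ∀ t, Measurable (B t))
    (hB : IsBrownianReal B P) (hXB : IndepFun (fun ω t => X t ω) (fun ω t => B t ω) P)

lemma measurable_increment_comap {s t : ℝ≥0} (h : s ≤ t) :
    Measurable[MeasurableSpace.comap (fun ω (u : ℝ≥0) => B (s + u) ω - B s ω) inferInstance]
      (fun ω => B t ω - B s ω) := by
  have := (measurable_pi_apply (t - s)).comp
    (comap_measurable (fun ω (u : ℝ≥0) => B (s + u) ω - B s ω))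
  simpa [Function.comp_def, add_tsub_cancel_of_le h] using this

lemma measurable_jointFiltration_left {r s : ℝ≥0} (h : r ≤ s) :
    Measurable[jointFiltration X B hXm hBm s] (X r) := by
  have h1 : Measurable[jointFiltration X B hXm hBm s] (fun ω => (X r ω, B r ω)) := by
    rw [measurable_iff_comap_le]
    exact le_iSup₂_of_le r h le_rfl
  exact measurable_fst.comp h1

lemma measurable_jointFiltration_right {r s : ℝ≥0} (h : r ≤ s) :
    Measurable[jointFiltration X B hXm hBm s] (B r) := by
  have h1 : Measurable[jointFiltration X B hXm hBm s] (fun ω => (X r ω, B r ω)) := by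
    rw [measurable_iff_comap_le]
    exact le_iSup₂_of_le r h le_rfl
  exact measurable_snd.comp h1

include hB hXB in
lemma memLp_mul_increment {a b : ℝ≥0} (hab : a ≤ b) {ξ : Ω → ℝ}
    (hξ : Measurable[jointFiltration X B hXm hBm a] ξ) (hξ2 : MemLp ξ 2 P) :
    MemLp (fun ω => ξ ω * (B b ω - B a ω)) 2 P :=
  memLp_mul_of_indepFun (indepFun_of_measurable_of_indep
    (indep_jointFiltration hXm hBm hB hXB a) hξ (measurable_increment_comap hab)) hξ2
    (memLp_increment hB a b)

include hB hXB in
lemma integral_mul_increment_eq_zero {c d : ℝ≥0} (hcd : c ≤ d) {W : Ω → ℝ}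
    (hW : Measurable[jointFiltration X B hXm hBm c] W) :
    ∫ ω, W ω * (B d ω - B c ω) ∂P = 0 := by
  have hind : IndepFun W (fun ω => B d ω - B c ω) P := indepFun_of_measurable_of_indep
    (indep_jointFiltration hXm hBm hB hXB c) hW (measurable_increment_comap hcd)
  have := hind.integral_mul_eq_mul_integral
    (hW.mono ((jointFiltration X B hXm hBm).le c) le_rfl).aestronglyMeasurable
    (memLp_increment hB c d).1
  rw [integral_increment hB, mul_zero] at this
  exact this

include hB hXB in
lemma integral_mul_increment_mul_increment {c b d : ℝ≥0} (hb : c ≤ b) (hd : c ≤ d) {W : Ω → ℝ}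
    (hW : Measurable[jointFiltration X B hXm hBm c] W) :
    ∫ ω, W ω * ((B b ω - B c ω) * (B d ω - B c ω)) ∂P = (∫ ω, W ω ∂P) * (min (b : ℝ) d - c) := by
  have hind : IndepFun W (fun ω => (B b ω - B c ω) * (B d ω - B c ω)) P :=
    indepFun_of_measurable_of_indep (indep_jointFiltration hXm hBm hB hXB c) hW
      ((measurable_increment_comap hb).mul (measurable_increment_comap hd))
  have := hind.integral_mul_eq_mul_integral
    (hW.mono ((jointFiltration X B hXm hBm).le c) le_rfl).aestronglyMeasurable
    ((memLp_increment hB c b).1.mul (memLp_increment hB c d).1)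
  rw [integral_increment_mul_increment hB hb hd] at this
  exact this

include hB hXB in
lemma integral_elementary_mul_of_le {a b c d : ℝ≥0} (hcd : c ≤ d) (hac : a ≤ c)
    {ξ η : Ω → ℝ} (hξ : Measurable[jointFiltration X B hXm hBm a] ξ)
    (hη : Measurable[jointFiltration X B hXm hBm c] η) (hξ2 : MemLp ξ 2 P) (hη2 : MemLp η 2 P) :
    ∫ ω, (ξ ω * (B b ω - B a ω)) * (η ω * (B d ω - B c ω)) ∂P =
      (∫ ω, ξ ω * η ω ∂P) * max 0 (min (b : ℝ) d - c) := by
  have hξc : Measurable[jointFiltration X B hXm hBm c] ξ :=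
    hξ.mono ((jointFiltration X B hXm hBm).mono hac) le_rfl
  have hBr : ∀ r ≤ c, Measurable[jointFiltration X B hXm hBm c] (B r) := fun r hr =>
    measurable_jointFiltration_right hXm hBm hr
  rcases le_total b c with hbc | hcb
  · have h0 := integral_mul_increment_eq_zero hXm hBm hB hXB hcd
      ((hξc.mul ((hBr b hbc).sub (hBr a hac))).mul hη)
    have hmax : max 0 (min (b : ℝ) d - c) = 0 := by
      refine max_eq_left (sub_nonpos.2 ((min_le_left _ _).trans (by exact_mod_cast hbc)))
    rw [hmax, mul_zero, ← h0]
    congr with ω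
    simp only [Pi.mul_apply, Pi.sub_apply]
    ring
  · have h0 := integral_mul_increment_eq_zero hXm hBm hB hXB hcd
      ((hξc.mul ((hBr c le_rfl).sub (hBr a hac))).mul hη)
    have h1 := integral_mul_increment_mul_increment hXm hBm hB hXB hcb hcd (hξc.mul hη)
    have hmax : max 0 (min (b : ℝ) d - c) = min (b : ℝ) d - c := by
      refine max_eq_right (sub_nonneg.2 (le_min ?_ ?_)) <;> assumption_mod_cast
    have hm1 := memLp_mul_increment hXm hBm hB hXB hac hξ hξ2
    have hm2 := memLp_mul_increment hXm hBm hB hXB hcd hη hη2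
    have hm3 := memLp_mul_increment hXm hBm hB hXB hcb hξc hξ2
    rw [hmax]
    simp only [Pi.mul_apply, Pi.sub_apply] at h0 h1
    rw [← h1, ← zero_add (∫ ω, ξ ω * η ω * _ ∂P), ← h0, ← integral_add]
    · congr with ω
      ring
    · refine (hm1.integrable_mul hm2).congr (ae_of_all _ fun ω => ?_)
      simp only [Pi.mul_apply]
      ring
    · refine (hm3.integrable_mul hm2).congr (ae_of_all _ fun ω => ?_)
      simp only [Pi.mul_apply]
      ring

include hB hXB in
/-- Covariance of two elementary stochastic integrals over `[0, t]`. -/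
lemma integral_elementary_mul (t : ℝ≥0) {a b c d : ℝ≥0} (hab : a ≤ b) (hcd : c ≤ d)
    {ξ η : Ω → ℝ} (hξ : Measurable[jointFiltration X B hXm hBm a] ξ)
    (hη : Measurable[jointFiltration X B hXm hBm c] η) (hξ2 : MemLp ξ 2 P) (hη2 : MemLp η 2 P) :
    ∫ ω, (ξ ω * (B (min b t) ω - B (min a t) ω)) * (η ω * (B (min d t) ω - B (min c t) ω)) ∂P =
      (∫ ω, ξ ω * η ω ∂P) * max 0 (min (min (b : ℝ) d) t - max (a : ℝ) c) := by
  wlog hac : a ≤ c generalizing a b c d ξ η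
  · have := this hcd hab hη hξ hη2 hξ2 (le_of_not_ge hac)
    rw [min_comm (b : ℝ), max_comm (a : ℝ)]
    simp_rw [mul_comm (ξ _) (η _)]
    rw [← this]
    congr with ω
    ring
  rw [max_eq_right (by exact_mod_cast hac : (a : ℝ) ≤ c)]
  rcases le_total t c with htc | hct
  · rw [min_eq_right htc, min_eq_right (htc.trans hcd),
      max_eq_left (sub_nonpos.2 ((min_le_right _ _).trans (by exact_mod_cast htc)))]
    simp
  · rw [min_eq_left hct, min_eq_left (hac.trans hct),
      integral_elementary_mul_of_le hXm hBm hB hXB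
        (le_min hcd hct) hac hξ hη hξ2 hη2]
    push_cast
    rw [← min_min_min_comm, min_self]

include hB hXB in
lemma memLp_elementary (t : ℝ≥0) {a b : ℝ≥0} (hab : a ≤ b) {ξ : Ω → ℝ}
    (hξ : Measurable[jointFiltration X B hXm hBm a] ξ) (hξ2 : MemLp ξ 2 P) :
    MemLp (fun ω => ξ ω * (B (min b t) ω - B (min a t) ω)) 2 P := by
  rcases le_total t a with hta | hat
  · simp [min_eq_right hta, min_eq_right (hta.trans hab)]
  · rw [min_eq_left hat]
    exact memLp_mul_increment hXm hBm hB hXB (le_min hab hat) hξ hξ2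

lemma integrable_indicator_mul_indicator (t a b c d : ℝ≥0) (x y : ℝ) :
    Integrable (fun s : ℝ => (Set.Ioc a b).indicator (fun _ => x) s.toNNReal *
      (Set.Ioc c d).indicator (fun _ => y) s.toNNReal) (volume.restrict (Set.Icc (0 : ℝ) t)) ∧
    ∫ s in Set.Icc (0 : ℝ) t, (Set.Ioc a b).indicator (fun _ => x) s.toNNReal *
      (Set.Ioc c d).indicator (fun _ => y) s.toNNReal =
        x * y * max 0 (min (min (b : ℝ) d) t - max (a : ℝ) c) := by
  have hset : ∀ s ∈ Set.Icc (0 : ℝ) t, (Set.Ioc a b).indicator (fun _ => x) s.toNNReal *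
      (Set.Ioc c d).indicator (fun _ => y) s.toNNReal =
      (Set.Ioc (max (a : ℝ) c) (min b d)).indicator (fun _ => x * y) s := by
    intro s hs
    lift s to ℝ≥0 using hs.1
    rw [Real.toNNReal_coe]
    simp only [Set.indicator_apply, Set.mem_Ioc, sup_lt_iff, le_inf_iff, NNReal.coe_lt_coe,
      NNReal.coe_le_coe]
    split_ifs <;> simp_all
  constructor
  · refine (integrableOn_congr_fun hset measurableSet_Icc).2 ?_
    exact ((integrable_const (x * y)).indicator measurableSet_Ioc)
  · have hinter : Set.Icc (0 : ℝ) t ∩ Set.Ioc (max (a : ℝ) c) (min b d) =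
        Set.Ioc (max (a : ℝ) c) (min (min (b : ℝ) d) t) := by
      ext s
      simp only [Set.mem_inter_iff, Set.mem_Icc, Set.mem_Ioc, sup_lt_iff, le_inf_iff]
      have := a.coe_nonneg
      constructor
      · tauto
      · rintro ⟨⟨h1, h2⟩, h3, h4⟩
        exact ⟨⟨by linarith, h4⟩, ⟨h1, h2⟩, h3⟩
    rw [setIntegral_congr_fun measurableSet_Icc hset, setIntegral_indicator measurableSet_Ioc,
      hinter, setIntegral_const, Real.volume_real_Ioc, smul_eq_mul, max_comm, mul_comm]

section Isometry

variable {ι : Type*} [Fintype ι] (a b : ι → ℝ≥0) (hab : ∀ i, a i ≤ b i) (ξ : ι → Ω → ℝ)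
  (hξ : ∀ i, Measurable[jointFiltration X B hXm hBm (a i)] (ξ i)) (hξ2 : ∀ i, MemLp (ξ i) 2 P)
  (t : ℝ≥0)

include hab hξ hξ2 hB hXB in
/-- The Itô isometry for finite sums of elementary processes. -/
lemma lintegral_enorm_sum_elementary_sq :
    ∫⁻ ω, ‖∑ i, ξ i ω * (B (min (b i) t) ω - B (min (a i) t) ω)‖ₑ ^ 2 ∂P =
      ∫⁻ ω, (∫⁻ s in Set.Icc (0 : ℝ) t,
        ‖∑ i, (Set.Ioc (a i) (b i)).indicator (fun _ => ξ i ω) s.toNNReal‖ₑ ^ 2) ∂P := by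
  have hsq : ∀ x : ℝ, ‖x‖ₑ ^ 2 = ENNReal.ofReal (x ^ 2) := fun x => by
    rw [← sq_abs, ENNReal.ofReal_pow (abs_nonneg x), Real.enorm_eq_ofReal_abs]
  set ℓ : ι → ι → ℝ := fun i j =>
    max 0 (min (min (b i : ℝ) (b j)) t - max (a i : ℝ) (a j)) with hℓ
  have hinner : ∀ ω, ∫⁻ s in Set.Icc (0 : ℝ) t,
      ‖∑ i, (Set.Ioc (a i) (b i)).indicator (fun _ => ξ i ω) s.toNNReal‖ₑ ^ 2 =
      ENNReal.ofReal (∑ i, ∑ j, ξ i ω * ξ j ω * ℓ i j) ∧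
      0 ≤ ∑ i, ∑ j, ξ i ω * ξ j ω * ℓ i j := by
    intro ω
    have hI := fun i j =>
      integrable_indicator_mul_indicator t (a i) (b i) (a j) (b j) (ξ i ω) (ξ j ω)
    have hint : Integrable (fun s : ℝ =>
        (∑ i, (Set.Ioc (a i) (b i)).indicator (fun _ => ξ i ω) s.toNNReal) ^ 2)
        (volume.restrict (Set.Icc (0 : ℝ) t)) := by
      simp_rw [sq, Finset.sum_mul_sum]
      exact integrable_finsetSum _ fun i _ => integrable_finsetSum _ fun j _ => (hI i j).1
    have heq : ∫ s in Set.Icc (0 : ℝ) t,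
        (∑ i, (Set.Ioc (a i) (b i)).indicator (fun _ => ξ i ω) s.toNNReal) ^ 2 =
        ∑ i, ∑ j, ξ i ω * ξ j ω * ℓ i j := by
      simp_rw [sq, Finset.sum_mul_sum]
      rw [integral_finsetSum _ fun i _ => integrable_finsetSum _ fun j _ => (hI i j).1]
      refine Finset.sum_congr rfl fun i _ => ?_
      rw [integral_finsetSum _ fun j _ => (hI i j).1]
      exact Finset.sum_congr rfl fun j _ => (hI i j).2
    simp_rw [hsq]
    rw [← heq]
    exact ⟨(ofReal_integral_eq_lintegral_ofReal hint (ae_of_all _ fun _ => sq_nonneg _)).symm,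
      integral_nonneg fun _ => sq_nonneg _⟩
  simp_rw [fun ω => (hinner ω).1, hsq]
  have hmem := fun i => memLp_elementary hXm hBm hB hXB t (hab i) (hξ i) (hξ2 i)
  have hint1 : ∀ i j, Integrable (fun ω => (ξ i ω * (B (min (b i) t) ω - B (min (a i) t) ω)) *
      (ξ j ω * (B (min (b j) t) ω - B (min (a j) t) ω))) P :=
    fun i j => (hmem i).integrable_mul (hmem j)
  have hint2 : ∀ i j, Integrable (fun ω => ξ i ω * ξ j ω * ℓ i j) P :=
    fun i j => ((hξ2 i).integrable_mul (hξ2 j)).mul_const _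
  rw [← ofReal_integral_eq_lintegral_ofReal _ (ae_of_all _ fun _ => sq_nonneg _),
    ← ofReal_integral_eq_lintegral_ofReal _ (ae_of_all _ fun ω => (hinner ω).2)]
  · congr 1
    simp_rw [sq, Finset.sum_mul_sum]
    rw [integral_finsetSum _ fun i _ => integrable_finsetSum _ fun j _ => hint1 i j,
      integral_finsetSum _ fun i _ => integrable_finsetSum _ fun j _ => hint2 i j]
    refine Finset.sum_congr rfl fun i _ => ?_
    rw [integral_finsetSum _ fun j _ => hint1 i j, integral_finsetSum _ fun j _ => hint2 i j]
    refine Finset.sum_congr rfl fun j _ => ?_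
    rw [integral_elementary_mul hXm hBm hB hXB t (hab i) (hab j) (hξ i) (hξ j) (hξ2 i) (hξ2 j),
      integral_mul_const]
  · exact integrable_finsetSum _ fun i _ => integrable_finsetSum _ fun j _ => hint2 i j
  · simp_rw [sq, Finset.sum_mul_sum]
    exact integrable_finsetSum _ fun i _ => integrable_finsetSum _ fun j _ => hint1 i j

end Isometry

include hB hXB in
/-- The Itô isometry for the difference of two simple processes. -/
lemma lintegral_enorm_integral_sub_sq (φ ψ : SimpleProcess (jointFiltration X B hXm hBm) P)
    (t : ℝ≥0) :
    ∫⁻ ω, ‖φ.integral B t ω - ψ.integral B t ω‖ₑ ^ 2 ∂P =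
      ∫⁻ ω, (∫⁻ s in Set.Icc (0 : ℝ) t,
        ‖φ.eval s.toNNReal ω - ψ.eval s.toNNReal ω‖ₑ ^ 2) ∂P := by
  have h := lintegral_enorm_sum_elementary_sq (ι := Fin φ.N ⊕ Fin ψ.N) hXm hBm hB hXB
    (Sum.elim (fun i => φ.time i) (fun i => ψ.time i))
    (Sum.elim (fun i => φ.time (i + 1)) (fun i => ψ.time (i + 1)))
    (by
      rintro (i | i)
      · exact φ.monotone_time (Nat.le_succ _)
      · exact ψ.monotone_time (Nat.le_succ _))
    (Sum.elim (fun i => φ.ξ i) (fun i => -ψ.ξ i))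
    (by
      rintro (i | i)
      · exact φ.measurable_ξ i
      · exact (ψ.measurable_ξ i).neg)
    (by
      rintro (i | i)
      · exact φ.memLp_ξ i
      · exact (ψ.memLp_ξ i).neg) t
  simp only [Fintype.sum_sum_type, Sum.elim_inl, Sum.elim_inr, Pi.neg_apply, neg_mul,
    Finset.sum_neg_distrib, ← sub_eq_add_neg] at h
  have hneg : ∀ (i : ℕ) (s : ℝ≥0) (ω : Ω), (Set.Ioc (ψ.time i) (ψ.time (i + 1))).indicator
      (fun _ => -ψ.ξ i ω) s = -(Set.Ioc (ψ.time i) (ψ.time (i + 1))).indicator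
      (fun _ => ψ.ξ i ω) s := fun i s ω => by
    rw [Set.indicator_apply, Set.indicator_apply]; split_ifs <;> simp
  simp only [hneg, Finset.sum_neg_distrib, ← sub_eq_add_neg] at h
  simp only [SimpleProcess.integral, SimpleProcess.eval, Finset.sum_range]
  exact h

end BrownianIncrements

end WeightedVariation

namespace WeightedVariation

variable {Ω : Type*} {mΩ : MeasurableSpace Ω} {P : Measure Ω}

lemma eLpNorm_two_sq {α : Type*} {mα : MeasurableSpace α} (μ : Measure α) (g : α → ℝ) :
    eLpNorm g 2 μ ^ 2 = ∫⁻ x, ‖g x‖ₑ ^ 2 ∂μ := by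
  have := eLpNorm_nnreal_pow_eq_lintegral (f := g) (μ := μ) (p := 2) (by simp)
  simpa using this

lemma enorm_sq_eq_ofReal (x : ℝ) : ‖x‖ₑ ^ 2 = ENNReal.ofReal (x ^ 2) := by
  rw [← sq_abs, ENNReal.ofReal_pow (abs_nonneg x), Real.enorm_eq_ofReal_abs]

lemma tendsto_zero_iff_sq {ι : Type*} {l : Filter ι} {u : ι → ℝ≥0∞} :
    Tendsto u l (𝓝 0) ↔ Tendsto (fun i => u i ^ 2) l (𝓝 0) := by
  constructor
  · intro h
    simpa [Function.comp_def] using (ENNReal.continuous_pow 2).tendsto 0 |>.comp h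
  · intro h
    have := ((ENNReal.continuous_rpow_const (y := 1 / 2)).tendsto 0).comp h
    have h0 : (0 : ℝ≥0∞) ^ (1 / 2 : ℝ) = 0 := ENNReal.zero_rpow_of_pos (by norm_num)
    rw [h0] at this
    refine this.congr fun i => ?_
    simp only [Function.comp]
    rw [← ENNReal.rpow_natCast, ← ENNReal.rpow_mul]
    norm_num

lemma eLpNorm_fun_sub_le {α : Type*} {mα : MeasurableSpace α} {μ : Measure α} {p : ℝ≥0∞}
    (hp : 1 ≤ p) {u v w : α → ℝ} (hu : AEStronglyMeasurable u μ) (hv : AEStronglyMeasurable v μ)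
    (hw : AEStronglyMeasurable w μ) :
    eLpNorm (fun x => u x - w x) p μ ≤
      eLpNorm (fun x => u x - v x) p μ + eLpNorm (fun x => v x - w x) p μ := by
  have h := eLpNorm_add_le (hu.sub hv) (hv.sub hw) hp
  rw [sub_add_sub_cancel] at h
  exact h

section LipschitzMoments

variable [IsProbabilityMeasure P] {X : ℝ≥0 → Ω → ℝ} {f : ℝ → ℝ} {L : ℝ≥0}

lemma memLp_comp_brownian (hX : IsBrownianReal X P) (hf : LipschitzWith L f) (s : ℝ≥0) :
    MemLp (fun ω => f (X s ω)) 2 P := by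
  have hXs : MemLp (X s) 2 P := (hX.isGaussianProcess.hasGaussianLaw_eval s).memLp_two
  have h := (hf.sub (LipschitzWith.const (f 0))).comp_memLp (by simp) hXs
  refine (h.add (memLp_const (f 0))).ae_eq (ae_of_all _ fun ω => ?_)
  simp

lemma integral_comp_brownian_sub_sq_le (hX : IsBrownianReal X P) (hf : LipschitzWith L f)
    (s r : ℝ≥0) :
    ∫ ω, (f (X s ω) - f (X r ω)) ^ 2 ∂P ≤ L ^ 2 * |(s : ℝ) - r| := by
  rw [← integral_increment_sq hX, ← integral_const_mul]
  refine integral_mono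
    ((memLp_comp_brownian hX hf s).sub (memLp_comp_brownian hX hf r)).integrable_sq
    ((memLp_increment hX r s).integrable_sq.const_mul _) fun ω => ?_
  have := hf.dist_le_mul (X s ω) (X r ω)
  rw [Real.dist_eq, Real.dist_eq] at this
  rw [← sq_abs, ← sq_abs (X s ω - X r ω), ← mul_pow]
  exact pow_le_pow_left₀ (abs_nonneg _) this 2

lemma integral_comp_brownian_sq_le (hX : IsBrownianReal X P) (hf : LipschitzWith L f)
    {s t : ℝ≥0} (hst : s ≤ t) :
    ∫ ω, f (X s ω) ^ 2 ∂P ≤ 2 * f 0 ^ 2 + 2 * L ^ 2 * t := by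
  have hm := (memLp_increment hX 0 s).integrable_sq
  calc ∫ ω, f (X s ω) ^ 2 ∂P ≤ ∫ ω, (2 * f 0 ^ 2 + 2 * L ^ 2 * (X s ω - X 0 ω) ^ 2) ∂P := by
        refine integral_mono_ae (memLp_comp_brownian hX hf s).integrable_sq
          ((integrable_const _).add (hm.const_mul _)) ?_
        filter_upwards [hX.eval_zero_ae_eq_zero] with ω hω
        have := hf.dist_le_mul (X s ω) 0
        rw [Real.dist_eq, Real.dist_eq] at this
        have h2 := pow_le_pow_left₀ (abs_nonneg _) this 2
        rw [mul_pow, sq_abs, sq_abs] at h2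
        rw [hω]
        nlinarith [sq_nonneg (f (X s ω) - 2 * f 0)]
    _ = 2 * f 0 ^ 2 + 2 * L ^ 2 * s := by
        rw [integral_add (integrable_const _) (hm.const_mul _),
          integral_const_mul (2 * (L : ℝ) ^ 2), integral_increment_sq hX]
        simp
    _ ≤ _ := by gcongr

end LipschitzMoments

section Modification

lemma exists_measurable_modification {X : ℝ≥0 → Ω → ℝ} (hXm : ∀ t, Measurable (X t))
    (hX : IsBrownianReal X P) :
    ∃ Y : ℝ≥0 → Ω → ℝ, Measurable (Function.uncurry Y) ∧ ∀ᵐ ω ∂P, ∀ s, Y s ω = X s ω := by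
  classical
  obtain ⟨A, hA, hAm, hA0⟩ := exists_measurable_superset_of_null (ae_iff.1 hX.cont)
  refine ⟨fun s => Aᶜ.indicator (X s), ?_, ?_⟩
  · refine measurable_uncurry_of_continuous_of_measurable (fun ω => ?_)
      fun s => (hXm s).indicator hAm.compl
    by_cases hω : ω ∈ A
    · simp [hω, continuous_const]
    · have : Continuous fun s => X s ω := by
        by_contra h
        exact hω (hA h)
      simpa [hω] using this
  · have : ∀ᵐ ω ∂P, ω ∉ A := measure_eq_zero_iff_ae_notMem.1 hA0
    filter_upwards [this] with ω hω s
    simp [hω]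

end Modification

section SimpleProcess

variable {F : Filtration ℝ≥0 mΩ}

/-- A simple process as a function on `Ω × ℝ`. -/
noncomputable def SimpleProcess.onProd (φ : SimpleProcess F P) (q : Ω × ℝ) : ℝ :=
  φ.eval q.2.toNNReal q.1

lemma SimpleProcess.measurable_onProd (φ : SimpleProcess F P) : Measurable φ.onProd := by
  unfold SimpleProcess.onProd SimpleProcess.eval
  refine Finset.measurable_fun_sum _ fun i _ => ?_
  have hset : MeasurableSet {q : Ω × ℝ | q.2.toNNReal ∈ Set.Ioc (φ.time i) (φ.time (i + 1))} :=
    (measurable_real_toNNReal.comp measurable_snd) measurableSet_Ioc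
  have := ((((φ.measurable_ξ i).mono (F.le _) le_rfl).comp measurable_fst).indicator hset)
  convert! this using 1

lemma SimpleProcess.memLp_integral_sub [IsProbabilityMeasure P] {X B : ℝ≥0 → Ω → ℝ}
    (hXm : ∀ t, Measurable (X t)) (hBm : ∀ t, Measurable (B t))
    (hB : IsBrownianReal B P) (hXB : IndepFun (fun ω t => X t ω) (fun ω t => B t ω) P)
    (φ : SimpleProcess (jointFiltration X B hXm hBm) P) (t : ℝ≥0) :
    MemLp (φ.integral B t) 2 P :=
  memLp_finsetSum _ fun i _ => memLp_elementary hXm hBm hB hXB t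
    (φ.monotone_time (Nat.le_succ i)) (φ.measurable_ξ i) (φ.memLp_ξ i)

end SimpleProcess

section Ito

variable [IsProbabilityMeasure P] {X B : ℝ≥0 → Ω → ℝ} {f : ℝ → ℝ} {L : ℝ≥0}
  (hXm : ∀ t, Measurable (X t)) (hBm : ∀ t, Measurable (B t))
  (hX : IsBrownianReal X P) (hB : IsBrownianReal B P)
  (hXB : IndepFun (fun ω t => X t ω) (fun ω t => B t ω) P)
  (hf : LipschitzWith L f)

include hB hXB in
lemma eLpNorm_integral_sub (φ ψ : SimpleProcess (jointFiltration X B hXm hBm) P) (t : ℝ≥0) :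
    eLpNorm (fun ω => φ.integral B t ω - ψ.integral B t ω) 2 P =
      eLpNorm (fun q => φ.onProd q - ψ.onProd q) 2
        (P.prod (volume.restrict (Set.Icc (0 : ℝ) t))) := by
  have h := lintegral_enorm_integral_sub_sq hXm hBm hB hXB φ ψ t
  have h2 : eLpNorm (fun ω => φ.integral B t ω - ψ.integral B t ω) 2 P ^ 2 =
      eLpNorm (fun q => φ.onProd q - ψ.onProd q) 2
        (P.prod (volume.restrict (Set.Icc (0 : ℝ) t))) ^ 2 := by
    rw [eLpNorm_two_sq, eLpNorm_two_sq, h, lintegral_prod]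
    · rfl
    · exact ((φ.measurable_onProd.sub ψ.measurable_onProd).enorm.pow_const 2).aemeasurable
  exact (ENNReal.pow_right_strictMono two_ne_zero).injective h2

omit [IsProbabilityMeasure P] in
lemma lintegral_eval_sub_eq [SFinite P] {Y : ℝ≥0 → Ω → ℝ} (hY : Measurable (Function.uncurry Y))
    (hYX : ∀ᵐ ω ∂P, ∀ s, Y s ω = X s ω) (hfm : Measurable f)
    {F : Filtration ℝ≥0 mΩ} (φ : SimpleProcess F P) (t : ℝ≥0) :
    ∫⁻ ω, (∫⁻ s in Set.Icc (0 : ℝ) t, ‖φ.eval s.toNNReal ω - f (X s.toNNReal ω)‖ₑ ^ 2) ∂P =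
      eLpNorm (fun q => φ.onProd q - f (Y q.2.toNNReal q.1)) 2
        (P.prod (volume.restrict (Set.Icc (0 : ℝ) t))) ^ 2 := by
  rw [eLpNorm_two_sq, lintegral_prod]
  · refine lintegral_congr_ae ?_
    filter_upwards [hYX] with ω hω
    simp only [hω, SimpleProcess.onProd]
  · have : Measurable fun q : Ω × ℝ => f (Y q.2.toNNReal q.1) :=
      hfm.comp (hY.comp ((measurable_real_toNNReal.comp measurable_snd).prodMk measurable_fst))
    exact ((φ.measurable_onProd.sub this).enorm.pow_const 2).aemeasurable

include hX hB hXB hf in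
/-- Distance between an elementary integral and the Itô integral. -/
lemma eLpNorm_integral_sub_ito_sq_le {t : ℝ≥0} {J : Ω → ℝ}
    (hJ : IsItoIntegral (jointFiltration X B hXm hBm) P B (fun s ω => f (X s ω)) t J)
    (ψ : SimpleProcess (jointFiltration X B hXm hBm) P) :
    eLpNorm (fun ω => ψ.integral B t ω - J ω) 2 P ^ 2 ≤
      ∫⁻ ω, (∫⁻ s in Set.Icc (0 : ℝ) t,
        ‖ψ.eval s.toNNReal ω - f (X s.toNNReal ω)‖ₑ ^ 2) ∂P := by
  obtain ⟨Y, hY, hYX⟩ := exists_measurable_modification hXm hX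
  obtain ⟨hJm, φ, h1, h2⟩ := hJ
  have hYm : Measurable fun q : Ω × ℝ => f (Y q.2.toNNReal q.1) := hf.continuous.measurable.comp
    (hY.comp ((measurable_real_toNNReal.comp measurable_snd).prodMk measurable_fst))
  simp_rw [lintegral_eval_sub_eq hY hYX hf.continuous.measurable] at h1 ⊢
  rw [← tendsto_zero_iff_sq] at h1
  refine pow_le_pow_left₀ zero_le ?_ 2
  set μ := P.prod (volume.restrict (Set.Icc (0 : ℝ) t)) with hμ
  have hint := fun φ => (SimpleProcess.memLp_integral_sub hXm hBm hB hXB φ t).1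
  have hlim : Tendsto (fun k => eLpNorm (fun q => ψ.onProd q - f (Y q.2.toNNReal q.1)) 2 μ +
      eLpNorm (fun q => (φ k).onProd q - f (Y q.2.toNNReal q.1)) 2 μ +
      eLpNorm (fun ω => (φ k).integral B t ω - J ω) 2 P) atTop
      (𝓝 (eLpNorm (fun q => ψ.onProd q - f (Y q.2.toNNReal q.1)) 2 μ + 0 + 0)) :=
    (tendsto_const_nhds.add h1).add h2
  rw [add_zero, add_zero] at hlim
  refine ge_of_tendsto' hlim fun k => ?_
  calc eLpNorm (fun ω => ψ.integral B t ω - J ω) 2 P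
      ≤ eLpNorm (fun ω => ψ.integral B t ω - (φ k).integral B t ω) 2 P +
        eLpNorm (fun ω => (φ k).integral B t ω - J ω) 2 P :=
        eLpNorm_fun_sub_le (by norm_num) (hint ψ) (hint (φ k)) hJm
    _ ≤ _ := by
        gcongr
        rw [eLpNorm_integral_sub hXm hBm hB hXB]
        refine (eLpNorm_fun_sub_le (by norm_num) ψ.measurable_onProd.aestronglyMeasurable
          hYm.aestronglyMeasurable (φ k).measurable_onProd.aestronglyMeasurable).trans_eq ?_
        congr 1
        exact eLpNorm_sub_comm (fun q : Ω × ℝ => f (Y q.2.toNNReal q.1)) (φ k).onProd 2 _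

/-- The simple process equal to `f (X (i δ))` on `(i δ, (i + 1) δ]` for `i < K`. -/
noncomputable def gridProcess (hX : IsBrownianReal X P) (hf : LipschitzWith L f) (δ : ℝ≥0) (K : ℕ) :
    SimpleProcess (jointFiltration X B hXm hBm) P where
  N := K
  time i := i * δ
  monotone_time := fun i j hij => by
    have : (i : ℝ≥0) ≤ j := by exact_mod_cast hij
    exact mul_le_mul_left this δ
  ξ i ω := f (X (i * δ) ω)
  measurable_ξ i := hf.continuous.measurable.comp
    (measurable_jointFiltration_left hXm hBm le_rfl)
  memLp_ξ i := memLp_comp_brownian hX hf _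

lemma gridProcess_eval_of_mem {δ : ℝ≥0} {K i : ℕ} (hi : i < K) {s : ℝ≥0}
    (hs : s ∈ Set.Ioc ((i : ℝ≥0) * δ) ((i + 1 : ℕ) * δ)) (ω : Ω) :
    (gridProcess hXm hBm hX hf δ K).eval s ω = f (X (i * δ) ω) := by
  simp only [SimpleProcess.eval, gridProcess]
  rw [Finset.sum_eq_single i, Set.indicator_of_mem hs]
  · intro j _ hji
    refine Set.indicator_of_notMem (fun hj => ?_) _
    have hmono : Monotone fun i : ℕ => (i : ℝ≥0) * δ := fun a b hab => by
      have : (a : ℝ≥0) ≤ b := by exact_mod_cast hab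
      exact mul_le_mul_left this δ
    exact Set.disjoint_left.1 (hmono.pairwise_disjoint_on_Ioc_succ hji) hj hs
  · intro h
    exact absurd (Finset.mem_range.2 hi) h

lemma gridProcess_eval_of_lt {δ : ℝ≥0} {K : ℕ} {s : ℝ≥0} (hs : s = 0 ∨ K * δ < s) (ω : Ω) :
    (gridProcess hXm hBm hX hf δ K).eval s ω = 0 := by
  simp only [SimpleProcess.eval, gridProcess]
  refine Finset.sum_eq_zero fun i hi => Set.indicator_of_notMem (fun h => ?_) _
  rcases hs with rfl | hs
  · simp at h
  · have h1 : ((i + 1 : ℕ) : ℝ≥0) ≤ K := by exact_mod_cast Finset.mem_range.1 hi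
    exact absurd (h.2.trans (mul_le_mul_left h1 δ)) (not_le.2 hs)

lemma lintegral_gridProcess_sub_sq_le {δ t s : ℝ≥0} (hδ : 0 < δ) (hst : s ≤ t) (K : ℕ) :
    ∫⁻ ω, ‖(gridProcess hXm hBm hX hf δ K).eval s ω - f (X s ω)‖ₑ ^ 2 ∂P ≤
      ENNReal.ofReal (L ^ 2 * δ) + (Set.Ioc (0 : ℝ) (K * δ))ᶜ.indicator
        (fun _ => ENNReal.ofReal (2 * f 0 ^ 2 + 2 * L ^ 2 * t)) (s : ℝ) := by
  by_cases hs : (s : ℝ) ∈ Set.Ioc (0 : ℝ) (K * δ)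
  · have hs0 : 0 < s := by exact_mod_cast hs.1
    have hsK : s ≤ K * δ := by exact_mod_cast hs.2
    obtain ⟨i, hi⟩ : ∃ i, ⌈s / δ⌉₊ = i + 1 :=
      Nat.exists_eq_succ_of_ne_zero (Nat.ceil_pos.2 (by positivity)).ne'
    have hmem : s ∈ Set.Ioc ((i : ℝ≥0) * δ) ((i + 1 : ℕ) * δ) := by
      constructor
      · rw [← lt_div_iff₀ hδ, ← Nat.lt_ceil]; lia
      · rw [← div_le_iff₀ hδ, ← Nat.ceil_le]; lia
    have hiK : i < K := by
      have : ⌈s / δ⌉₊ ≤ K := Nat.ceil_le.2 ((div_le_iff₀ hδ).2 hsK)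
      lia
    refine le_add_of_le_of_nonneg ?_ zero_le
    simp_rw [gridProcess_eval_of_mem hXm hBm hX hf hiK hmem, enorm_sq_eq_ofReal]
    have hint : Integrable (fun ω => (f (X (i * δ) ω) - f (X s ω)) ^ 2) P :=
      ((memLp_comp_brownian hX hf _).sub (memLp_comp_brownian hX hf _)).integrable_sq
    rw [← ofReal_integral_eq_lintegral_ofReal hint (ae_of_all _ fun _ => sq_nonneg _)]
    refine ENNReal.ofReal_le_ofReal ((integral_comp_brownian_sub_sq_le hX hf _ _).trans ?_)
    gcongr
    have h1 : (i : ℝ) * δ < s := by exact_mod_cast hmem.1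
    have h2 : (s : ℝ) ≤ (i + 1) * δ := by exact_mod_cast hmem.2
    push_cast
    rw [abs_sub_comm, abs_of_pos (by linarith)]
    linarith
  · have hs' : s = 0 ∨ K * δ < s := by
      by_contra! h
      exact hs ⟨by exact_mod_cast pos_iff_ne_zero.2 h.1, by exact_mod_cast h.2⟩
    refine le_add_of_nonneg_of_le zero_le ?_
    rw [Set.indicator_of_mem hs]
    simp_rw [gridProcess_eval_of_lt hXm hBm hX hf hs', zero_sub, enorm_neg, enorm_sq_eq_ofReal]
    rw [← ofReal_integral_eq_lintegral_ofReal (memLp_comp_brownian hX hf _).integrable_sq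
      (ae_of_all _ fun _ => sq_nonneg _)]
    exact ENNReal.ofReal_le_ofReal (integral_comp_brownian_sq_le hX hf hst)

lemma lintegral_lintegral_gridProcess_sub_sq_le {δ t : ℝ≥0} (hδ : 0 < δ) {K : ℕ}
    (hK : K = ⌊t / δ⌋₊) :
    ∫⁻ ω, (∫⁻ s in Set.Icc (0 : ℝ) t,
      ‖(gridProcess hXm hBm hX hf δ K).eval s.toNNReal ω - f (X s.toNNReal ω)‖ₑ ^ 2) ∂P ≤
      ENNReal.ofReal ((L ^ 2 * t + (2 * f 0 ^ 2 + 2 * L ^ 2 * t)) * δ) := by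
  obtain ⟨Y, hY, hYX⟩ := exists_measurable_modification hXm hX
  have hYm : Measurable fun q : Ω × ℝ => f (Y q.2.toNNReal q.1) := hf.continuous.measurable.comp
    (hY.comp ((measurable_real_toNNReal.comp measurable_snd).prodMk measurable_fst))
  have hm : Measurable fun q : Ω × ℝ =>
      ‖(gridProcess hXm hBm hX hf δ K).onProd q - f (Y q.2.toNNReal q.1)‖ₑ ^ 2 :=
    (((gridProcess hXm hBm hX hf δ K).measurable_onProd.sub hYm).enorm.pow_const 2)
  rw [lintegral_eval_sub_eq hY hYX hf.continuous.measurable, eLpNorm_two_sq,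
    lintegral_prod_symm _ hm.aemeasurable]
  set D := 2 * f 0 ^ 2 + 2 * L ^ 2 * t
  have hKt : (K : ℝ) * δ ≤ t := by
    have : (K : ℝ≥0) * δ ≤ t := by
      rw [← le_div_iff₀ hδ, hK]; exact Nat.floor_le zero_le
    exact_mod_cast this
  have htK : (t : ℝ) < (K + 1) * δ := by
    have : t < (K + 1) * δ := by
      rw [← div_lt_iff₀ hδ, hK]; exact Nat.lt_floor_add_one _
    exact_mod_cast this
  calc _ ≤ ∫⁻ s in Set.Icc (0 : ℝ) t, (ENNReal.ofReal (L ^ 2 * δ) +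
        (Set.Ioc (0 : ℝ) (K * δ))ᶜ.indicator (fun _ => ENNReal.ofReal D) s) := by
        refine setLIntegral_mono' measurableSet_Icc fun s hs => ?_
        have h := lintegral_gridProcess_sub_sq_le hXm hBm hX hf hδ
          (Real.toNNReal_le_iff_le_coe.2 hs.2) K
        rw [Real.coe_toNNReal _ hs.1] at h
        refine (lintegral_congr_ae ?_).trans_le h
        filter_upwards [hYX] with ω hω
        simp only [hω, SimpleProcess.onProd]
    _ = ENNReal.ofReal (L ^ 2 * δ) * ENNReal.ofReal t + ENNReal.ofReal D *
        volume ((Set.Ioc (0 : ℝ) (K * δ))ᶜ ∩ Set.Icc (0 : ℝ) t) := by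
        rw [lintegral_add_left measurable_const, lintegral_indicator measurableSet_Ioc.compl,
          lintegral_const, lintegral_const, Measure.restrict_apply_univ,
          Measure.restrict_apply_univ, Measure.restrict_apply measurableSet_Ioc.compl,
          Real.volume_Icc, sub_zero]
    _ ≤ ENNReal.ofReal (L ^ 2 * δ) * ENNReal.ofReal t + ENNReal.ofReal D *
        ENNReal.ofReal δ := by
        gcongr
        have hsub : (Set.Ioc (0 : ℝ) (K * δ))ᶜ ∩ Set.Icc (0 : ℝ) t ⊆
            {0} ∪ Set.Ioc ((K : ℝ) * δ) t := by
          rintro s ⟨h1, h2, h3⟩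
          by_cases h0 : s = 0
          · exact Or.inl h0
          · refine Or.inr ⟨?_, h3⟩
            by_contra! h4
            exact h1 ⟨lt_of_le_of_ne h2 (Ne.symm h0), h4⟩
        refine (measure_mono hsub).trans ((measure_union_le _ _).trans ?_)
        rw [Real.volume_singleton, zero_add, Real.volume_Ioc]
        exact ENNReal.ofReal_le_ofReal (by linarith)
    _ = _ := by
        have hD : 0 ≤ D := by positivity
        rw [← ENNReal.ofReal_mul (by positivity), ← ENNReal.ofReal_mul hD,
          ← ENNReal.ofReal_add (by positivity) (by positivity)]
        congr 1
        ring

include hX hB hXB hf in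
lemma exists_isItoIntegral (t : ℝ≥0) :
    ∃ J : Ω → ℝ, IsItoIntegral (jointFiltration X B hXm hBm) P B (fun s ω => f (X s ω)) t J := by
  obtain ⟨Y, hY, hYX⟩ := exists_measurable_modification hXm hX
  have hYm : Measurable fun q : Ω × ℝ => f (Y q.2.toNNReal q.1) := hf.continuous.measurable.comp
    (hY.comp ((measurable_real_toNNReal.comp measurable_snd).prodMk measurable_fst))
  set C : ℝ := L ^ 2 * t + (2 * f 0 ^ 2 + 2 * L ^ 2 * t) with hC
  have hC0 : 0 ≤ C := by positivity
  set δ : ℕ → ℝ≥0 := fun k => (1 / 4) ^ k with hδ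
  have hδ0 : ∀ k, 0 < δ k := fun k => by positivity
  set φ : ℕ → SimpleProcess (jointFiltration X B hXm hBm) P := fun k =>
    gridProcess hXm hBm hX hf (δ k) ⌊t / δ k⌋₊ with hφ
  set μ := P.prod (volume.restrict (Set.Icc (0 : ℝ) t)) with hμ
  have hbound := fun k => lintegral_lintegral_gridProcess_sub_sq_le hXm hBm hX hf (hδ0 k)
    (rfl : ⌊t / δ k⌋₊ = ⌊t / δ k⌋₊)
  have hlim : Tendsto (fun k => ENNReal.ofReal (C * δ k)) atTop (𝓝 0) := by
    have h1 : Tendsto (fun k => (δ k : ℝ)) atTop (𝓝 0) := by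
      simpa [hδ] using tendsto_pow_atTop_nhds_zero_of_lt_one (r := (1 / 4 : ℝ)) (by norm_num)
        (by norm_num)
    simpa [Function.comp_def] using (ENNReal.continuous_ofReal.tendsto _).comp (h1.const_mul C)
  have ha : ∀ k, eLpNorm (fun q => (φ k).onProd q - f (Y q.2.toNNReal q.1)) 2 μ ≤
      ENNReal.ofReal (√C * (1 / 2) ^ k) := by
    intro k
    have h := hbound k
    rw [lintegral_eval_sub_eq hY hYX hf.continuous.measurable] at h
    refine (ENNReal.pow_le_pow_left_iff two_ne_zero).1 ?_
    refine h.trans (le_of_eq ?_)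
    rw [← ENNReal.ofReal_pow (by positivity), mul_pow, Real.sq_sqrt hC0, ← pow_mul, mul_comm k,
      pow_mul]
    congr 2
    simp only [hδ]
    push_cast
    norm_num
  have hsum : ∑' k, ENNReal.ofReal ((2 * √C + 1) * (1 / 2) ^ k) ≠ ∞ := by
    rw [← ENNReal.ofReal_tsum_of_nonneg (fun k => by positivity)
      ((summable_geometric_of_lt_one (by norm_num) (by norm_num)).mul_left _)]
    exact ENNReal.ofReal_ne_top
  have hcau : ∀ N n m : ℕ, N ≤ n → N ≤ m →
      eLpNorm ((φ n).integral B t - (φ m).integral B t) 2 P <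
        ENNReal.ofReal ((2 * √C + 1) * (1 / 2) ^ N) := by
    intro N n m hn hm
    have h1 : ∀ n, N ≤ n → √C * (1 / 2) ^ n ≤ √C * (1 / 2) ^ N := fun n hn =>
      mul_le_mul_of_nonneg_left (pow_le_pow_of_le_one (by norm_num) (by norm_num) hn)
        (Real.sqrt_nonneg C)
    calc _ = eLpNorm (fun q => (φ n).onProd q - (φ m).onProd q) 2 μ :=
          eLpNorm_integral_sub hXm hBm hB hXB (φ n) (φ m) t
      _ ≤ eLpNorm (fun q => (φ n).onProd q - f (Y q.2.toNNReal q.1)) 2 μ +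
          eLpNorm (fun q => (φ m).onProd q - f (Y q.2.toNNReal q.1)) 2 μ := by
          refine (eLpNorm_fun_sub_le (by norm_num) (φ n).measurable_onProd.aestronglyMeasurable
            hYm.aestronglyMeasurable (φ m).measurable_onProd.aestronglyMeasurable).trans_eq ?_
          congr 1
          exact eLpNorm_sub_comm (fun q : Ω × ℝ => f (Y q.2.toNNReal q.1)) (φ m).onProd 2 _
      _ ≤ ENNReal.ofReal (√C * (1 / 2) ^ n) + ENNReal.ofReal (√C * (1 / 2) ^ m) :=
          add_le_add (ha n) (ha m)
      _ < _ := by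
          rw [← ENNReal.ofReal_add (by positivity) (by positivity),
            ENNReal.ofReal_lt_ofReal_iff (by positivity)]
          have := h1 n hn
          have := h1 m hm
          have : (0 : ℝ) < (1 / 2) ^ N := by positivity
          linarith
  obtain ⟨J, hJ, hJlim⟩ := Lp.cauchy_complete_eLpNorm (p := 2) (by norm_num)
    (fun k => SimpleProcess.memLp_integral_sub hXm hBm hB hXB (φ k) t) hsum hcau
  refine ⟨J, hJ.1, φ, ?_, hJlim⟩
  exact tendsto_of_tendsto_of_tendsto_of_le_of_le tendsto_const_nhds hlim (fun _ => zero_le)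
    hbound

end Ito

end WeightedVariation

namespace WeightedVariation

variable {Ω : Type*} {mΩ : MeasurableSpace Ω} {P : Measure Ω}

section Orthogonality

/-- Second moment of a martingale transform. -/
lemma integral_sum_mul_sq [IsProbabilityMeasure P] {m m' : ℕ → MeasurableSpace Ω}
    (hmono : Monotone m) (hm : ∀ i, m i ≤ mΩ) (hind : ∀ i, Indep (m i) (m' i) P)
    {w ζ : ℕ → Ω → ℝ} (hw : ∀ i, Measurable[m i] (w i)) (hζ : ∀ i, Measurable[m (i + 1)] (ζ i))
    (hζ' : ∀ i, Measurable[m' i] (ζ i)) (hw2 : ∀ i, MemLp (w i) 2 P)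
    (hζ2 : ∀ i, MemLp (ζ i) 2 P) (h0 : ∀ i, ∫ ω, ζ i ω ∂P = 0) (N : ℕ) :
    MemLp (fun ω => ∑ i ∈ Finset.range N, w i ω * ζ i ω) 2 P ∧
    ∫ ω, (∑ i ∈ Finset.range N, w i ω * ζ i ω) ^ 2 ∂P =
      ∑ i ∈ Finset.range N, (∫ ω, w i ω ^ 2 ∂P) * ∫ ω, ζ i ω ^ 2 ∂P := by
  have hmem : ∀ i, MemLp (fun ω => w i ω * ζ i ω) 2 P := fun i =>
    memLp_mul_of_indepFun (indepFun_of_measurable_of_indep (hind i) (hw i) (hζ' i)) (hw2 i) (hζ2 i)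
  have hS : ∀ N, MemLp (fun ω => ∑ i ∈ Finset.range N, w i ω * ζ i ω) 2 P := fun N =>
    memLp_finsetSum _ fun i _ => hmem i
  refine ⟨hS N, ?_⟩
  induction N with
  | zero => simp
  | succ N ih =>
    have hSm : Measurable[m N] (fun ω => ∑ i ∈ Finset.range N, w i ω * ζ i ω) := by
      refine Finset.measurable_fun_sum _ fun i hi => ?_
      have hiN := Finset.mem_range.1 hi
      exact ((hw i).mono (hmono hiN.le) le_rfl).mul ((hζ i).mono (hmono hiN) le_rfl)
    have hcross : ∫ ω, ((∑ i ∈ Finset.range N, w i ω * ζ i ω) * w N ω) * ζ N ω ∂P = 0 := by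
      have := (indepFun_of_measurable_of_indep (hind N) (hSm.mul (hw N))
        (hζ' N)).integral_mul_eq_mul_integral
        ((hSm.mul (hw N)).mono (hm N) le_rfl).aestronglyMeasurable (hζ2 N).1
      rw [h0, mul_zero] at this
      exact this
    have hsq : ∫ ω, (w N ω * ζ N ω) ^ 2 ∂P = (∫ ω, w N ω ^ 2 ∂P) * ∫ ω, ζ N ω ^ 2 ∂P := by
      have := ((indepFun_of_measurable_of_indep (hind N) (hw N) (hζ' N)).comp
        (φ := fun x : ℝ => x ^ 2) (ψ := fun x : ℝ => x ^ 2) (by fun_prop)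
        (by fun_prop)).integral_mul_eq_mul_integral (hw2 N).integrable_sq.1 (hζ2 N).integrable_sq.1
      simp only [mul_pow]
      exact this
    have hcrossint : Integrable (fun ω =>
        ((∑ i ∈ Finset.range N, w i ω * ζ i ω) * w N ω) * ζ N ω) P := by
      refine ((hS N).integrable_mul (hmem N)).congr (ae_of_all _ fun ω => ?_)
      simp only [Pi.mul_apply]
      ring
    have hexp : ∀ ω, (∑ i ∈ Finset.range (N + 1), w i ω * ζ i ω) ^ 2 =
        (∑ i ∈ Finset.range N, w i ω * ζ i ω) ^ 2 +
        2 * (((∑ i ∈ Finset.range N, w i ω * ζ i ω) * w N ω) * ζ N ω) + (w N ω * ζ N ω) ^ 2 := by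
      intro ω
      rw [Finset.sum_range_succ]
      ring
    have hadd : Integrable (fun ω => (∑ i ∈ Finset.range N, w i ω * ζ i ω) ^ 2 +
        2 * (((∑ i ∈ Finset.range N, w i ω * ζ i ω) * w N ω) * ζ N ω)) P :=
      (hS N).integrable_sq.add (hcrossint.const_mul 2)
    simp_rw [hexp]
    rw [integral_add hadd (hmem N).integrable_sq,
      integral_add (hS N).integrable_sq (hcrossint.const_mul 2), integral_const_mul, hcross, ih,
      hsq, Finset.sum_range_succ]
    ring

end Orthogonality

section GaussianPolynomials

lemma integrable_eval_gaussianReal (q : Polynomial ℝ) :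
    Integrable (fun x => q.eval x) (gaussianReal 0 1) := by
  simp_rw [Polynomial.eval_eq_sum_range]
  refine integrable_finsetSum _ fun i _ => Integrable.const_mul ?_ _
  have := (memLp_id_gaussianReal (μ := 0) (v := 1) (i : ℝ≥0)).integrable_norm_pow' (p := i)
  refine (integrable_norm_iff (by fun_prop)).1 ?_
  simpa using this

lemma integrable_gaussianReal_of_eq_eval {g : ℝ → ℝ} (q : Polynomial ℝ)
    (h : ∀ x, q.eval x = g x) : Integrable g (gaussianReal 0 1) :=
  (integrable_eval_gaussianReal q).congr (ae_of_all _ h)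

lemma memLp_eval_gaussianReal (q : Polynomial ℝ) :
    MemLp (fun x => q.eval x) 2 (gaussianReal 0 1) := by
  refine (memLp_two_iff_integrable_sq (by fun_prop)).2 ?_
  exact integrable_gaussianReal_of_eq_eval (q ^ 2) (by simp)

lemma integral_mul_sub_gaussianMean_add {p : Polynomial ℝ} (a b : ℝ) :
    ∫ x, (a * (p.eval x - gaussianMean p) + b * x) ∂(gaussianReal 0 1) = 0 := by
  have h1 : Integrable (fun x : ℝ => p.eval x - gaussianMean p) (gaussianReal 0 1) :=
    (integrable_eval_gaussianReal p).sub (integrable_const _)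
  have h2 : Integrable (fun x : ℝ => x) (gaussianReal 0 1) :=
    integrable_gaussianReal_of_eq_eval Polynomial.X (by simp)
  rw [integral_add (h1.const_mul a) (h2.const_mul b), integral_const_mul, integral_const_mul,
    integral_sub (integrable_eval_gaussianReal p) (integrable_const _), integral_id_gaussianReal]
  simp [gaussianMean]

lemma integral_sq_gaussianReal : ∫ x, x ^ 2 ∂(gaussianReal 0 1) = 1 := by
  have h := variance_id_gaussianReal (μ := 0) (v := 1)
  rw [variance_eq_integral (by fun_prop)] at h
  simpa using h

lemma integral_mul_sub_gaussianMean {p : Polynomial ℝ} (hp : HasCenteredHermiteRankGeTwo p) :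
    ∫ x, x * (p.eval x - gaussianMean p) ∂(gaussianReal 0 1) = 0 := by
  have h1 : Integrable (fun x : ℝ => x * p.eval x) (gaussianReal 0 1) :=
    integrable_gaussianReal_of_eq_eval (Polynomial.X * p) (by simp)
  have h2 : Integrable (fun x : ℝ => x) (gaussianReal 0 1) :=
    integrable_gaussianReal_of_eq_eval Polynomial.X (by simp)
  simp_rw [mul_sub]
  rw [integral_sub h1 (h2.mul_const _), integral_mul_const, integral_id_gaussianReal,
    show ∫ x, x * p.eval x ∂(gaussianReal 0 1) = 0 from hp]
  simp

lemma integral_mul_sub_gaussianMean_add_sq {p : Polynomial ℝ}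
    (hp : HasCenteredHermiteRankGeTwo p) (a b : ℝ) :
    ∫ x, (a * (p.eval x - gaussianMean p) + b * x) ^ 2 ∂(gaussianReal 0 1) =
      a ^ 2 * gaussianVar p + b ^ 2 := by
  have h1 : Integrable (fun x : ℝ => (p.eval x - gaussianMean p) ^ 2) (gaussianReal 0 1) :=
    integrable_gaussianReal_of_eq_eval ((p - Polynomial.C (gaussianMean p)) ^ 2) (by simp)
  have h2 : Integrable (fun x : ℝ => x ^ 2) (gaussianReal 0 1) :=
    integrable_gaussianReal_of_eq_eval (Polynomial.X ^ 2) (by simp)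
  have h3 : Integrable (fun x : ℝ => x * (p.eval x - gaussianMean p)) (gaussianReal 0 1) :=
    integrable_gaussianReal_of_eq_eval (Polynomial.X * (p - Polynomial.C (gaussianMean p))) (by simp)
  have hV : gaussianVar p = ∫ x, (p.eval x - gaussianMean p) ^ 2 ∂(gaussianReal 0 1) := by
    rw [gaussianVar, variance_eq_integral (by fun_prop)]
    rfl
  have hexp : ∀ x, (a * (p.eval x - gaussianMean p) + b * x) ^ 2 =
      a ^ 2 * (p.eval x - gaussianMean p) ^ 2 + 2 * a * b * (x * (p.eval x - gaussianMean p)) +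
      b ^ 2 * x ^ 2 := fun x => by ring
  have h13 : Integrable (fun x => a ^ 2 * (p.eval x - gaussianMean p) ^ 2 +
      2 * a * b * (x * (p.eval x - gaussianMean p))) (gaussianReal 0 1) :=
    (h1.const_mul _).add (h3.const_mul _)
  simp_rw [hexp]
  rw [integral_add h13 (h2.const_mul _),
    integral_add (h1.const_mul _) (h3.const_mul _), integral_const_mul, integral_const_mul,
    integral_const_mul, integral_mul_sub_gaussianMean hp, integral_sq_gaussianReal, hV]
  ring

/-- The polynomial `φ(j) (p - E[p(G)]) + γ (-1)^j X` with `j = i + 1`. -/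
noncomputable def weightPoly (p : Polynomial ℝ) (α β γ : ℝ) (i : ℕ) : Polynomial ℝ :=
  Polynomial.C (alternating α β (i + 1)) * (p - Polynomial.C (gaussianMean p)) +
    Polynomial.C (γ * (-1) ^ (i + 1)) * Polynomial.X

variable {p : Polynomial ℝ} {α β γ : ℝ}

lemma eval_weightPoly (i : ℕ) (x : ℝ) : (weightPoly p α β γ i).eval x =
    alternating α β (i + 1) * (p.eval x - gaussianMean p) + γ * (-1) ^ (i + 1) * x := by
  simp [weightPoly]

lemma weightPoly_of_even {i : ℕ} (hi : Even i) : weightPoly p α β γ i = weightPoly p α β γ 0 := by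
  have h1 : ¬ Even (i + 1) := by simpa [Nat.even_add_one] using hi
  simp [weightPoly, alternating, h1, pow_succ, hi.neg_one_pow]

lemma weightPoly_of_odd {i : ℕ} (hi : Odd i) : weightPoly p α β γ i = weightPoly p α β γ 1 := by
  have h1 : Even (i + 1) := hi.add_one
  simp [weightPoly, alternating, h1, pow_succ, hi.neg_one_pow]

lemma exists_bound_weightPoly (p : Polynomial ℝ) (α β γ : ℝ) (G : Polynomial ℝ → ℝ) :
    ∃ Q, 0 ≤ Q ∧ ∀ i, G (weightPoly p α β γ i) ≤ Q := by
  refine ⟨|G (weightPoly p α β γ 0)| + |G (weightPoly p α β γ 1)|, by positivity, fun i => ?_⟩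
  rcases Nat.even_or_odd i with h | h
  · rw [weightPoly_of_even h]
    exact (le_abs_self _).trans (le_add_of_nonneg_right (abs_nonneg _))
  · rw [weightPoly_of_odd h]
    exact (le_abs_self _).trans (le_add_of_nonneg_left (abs_nonneg _))

lemma integral_weightPoly (i : ℕ) :
    ∫ x, (weightPoly p α β γ i).eval x ∂(gaussianReal 0 1) = 0 := by
  simp_rw [eval_weightPoly]
  exact integral_mul_sub_gaussianMean_add _ _

lemma integral_mul_weightPoly (hp : HasCenteredHermiteRankGeTwo p) (i : ℕ) :
    ∫ x, x * (weightPoly p α β γ i).eval x ∂(gaussianReal 0 1) = γ * (-1) ^ (i + 1) := by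
  have h2 : Integrable (fun x : ℝ => x ^ 2) (gaussianReal 0 1) :=
    integrable_gaussianReal_of_eq_eval (Polynomial.X ^ 2) (by simp)
  have h3 : Integrable (fun x : ℝ => x * (p.eval x - gaussianMean p)) (gaussianReal 0 1) :=
    integrable_gaussianReal_of_eq_eval (Polynomial.X * (p - Polynomial.C (gaussianMean p))) (by simp)
  have hexp : ∀ x, x * (weightPoly p α β γ i).eval x = alternating α β (i + 1) *
      (x * (p.eval x - gaussianMean p)) + γ * (-1) ^ (i + 1) * x ^ 2 := fun x => by
    rw [eval_weightPoly]; ring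
  simp_rw [hexp]
  rw [integral_add (h3.const_mul _) (h2.const_mul _), integral_const_mul, integral_const_mul,
    integral_mul_sub_gaussianMean hp, integral_sq_gaussianReal]
  ring

end GaussianPolynomials

section NormalizedIncrements

/-- The normalized increment of `X` over `[i h, (i + 1) h]`. -/
noncomputable def normIncr (X : ℝ≥0 → Ω → ℝ) (h : ℝ≥0) (i : ℕ) (ω : Ω) : ℝ :=
  (X ((i + 1 : ℕ) * h) ω - X (i * h) ω) / √h

/-- The `σ`-algebra generated by `X` up to time `s`. -/
@[reducible] def past (X : ℝ≥0 → Ω → ℝ) (s : ℝ≥0) : MeasurableSpace Ω :=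
  MeasurableSpace.comap (fun ω (r : Set.Iic s) => X r ω) inferInstance

variable {X : ℝ≥0 → Ω → ℝ}

lemma measurable_past {r s : ℝ≥0} (hrs : r ≤ s) : Measurable[past X s] (X r) :=
  (measurable_pi_apply (⟨r, hrs⟩ : Set.Iic s)).comp
    (comap_measurable (fun ω (r : Set.Iic s) => X r ω))

lemma past_mono : Monotone (past X) := by
  intro s t hst
  rw [past, ← measurable_iff_comap_le]
  refine @measurable_pi_lambda _ _ _ (past X t) _ _ fun r => ?_
  exact measurable_past (r.2.trans hst)

lemma past_le (hXm : ∀ t, Measurable (X t)) (s : ℝ≥0) : past X s ≤ mΩ := by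
  rw [past, ← measurable_iff_comap_le]
  fun_prop

lemma indep_past (hX : IsBrownianReal X P) (s : ℝ≥0) :
    Indep (past X s)
      (MeasurableSpace.comap (fun ω (u : ℝ≥0) => X (s + u) ω - X s ω) inferInstance) P :=
  (hX.indepFun_shift s).symm

lemma measurable_normIncr (hXm : ∀ t, Measurable (X t)) (h : ℝ≥0) (i : ℕ) :
    Measurable (normIncr X h i) :=
  ((hXm _).sub (hXm _)).div_const _

lemma cast_mul_le_succ (h : ℝ≥0) (i : ℕ) : (i : ℝ≥0) * h ≤ (i + 1 : ℕ) * h :=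
  mul_le_mul_left (by exact_mod_cast Nat.le_succ i) h

lemma measurable_normIncr_past (h : ℝ≥0) (i : ℕ) :
    Measurable[past X ((i + 1 : ℕ) * h)] (normIncr X h i) :=
  ((measurable_past le_rfl).sub (measurable_past (cast_mul_le_succ h i))).div_const _

lemma measurable_normIncr_comap (h : ℝ≥0) (i : ℕ) :
    Measurable[MeasurableSpace.comap (fun ω (u : ℝ≥0) => X (i * h + u) ω - X (i * h) ω)
      inferInstance] (normIncr X h i) :=
  (measurable_increment_comap (cast_mul_le_succ h i)).div_const _

lemma hasLaw_normIncr (hX : IsBrownianReal X P) {h : ℝ≥0} (hh : 0 < h) (i : ℕ) :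
    HasLaw (normIncr X h i) (gaussianReal 0 1) P := by
  have h0 : HasLaw (X ((i + 1 : ℕ) * h) - X (i * h)) (gaussianReal 0 h) P := by
    have hd : nndist (((i + 1 : ℕ) * h : ℝ≥0)).1 ((i * h : ℝ≥0)).1 = h := by
      ext
      rw [coe_nndist, Real.dist_eq, NNReal.val_eq_coe, NNReal.val_eq_coe]
      push_cast
      rw [add_mul, add_sub_cancel_left, one_mul, abs_of_pos (by exact_mod_cast hh)]
    have h1 := hX.hasLaw_sub ((i + 1 : ℕ) * h) (i * h)
    rwa [hd] at h1
  have h1 := gaussianReal_div_const h0 (√h)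
  convert! h1 using 2
  · simp
  · ext
    simp [hh.ne']

lemma integral_comp_normIncr (hX : IsBrownianReal X P) {h : ℝ≥0} (hh : 0 < h) (i : ℕ)
    {g : ℝ → ℝ} (hg : Measurable g) :
    ∫ ω, g (normIncr X h i ω) ∂P = ∫ x, g x ∂(gaussianReal 0 1) :=
  (hasLaw_normIncr hX hh i).integral_comp hg.aestronglyMeasurable

lemma integrable_eval_normIncr (hX : IsBrownianReal X P) {h : ℝ≥0} (hh : 0 < h) (i : ℕ)
    (q : Polynomial ℝ) : Integrable (fun ω => q.eval (normIncr X h i ω)) P := by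
  have hl := hasLaw_normIncr hX hh i
  have := integrable_eval_gaussianReal q
  rw [← hl.map_eq] at this
  exact this.comp_aemeasurable hl.aemeasurable

lemma memLp_eval_normIncr (hX : IsBrownianReal X P) {h : ℝ≥0} (hh : 0 < h) (i : ℕ)
    (q : Polynomial ℝ) : MemLp (fun ω => q.eval (normIncr X h i ω)) 2 P := by
  have hl := hasLaw_normIncr hX hh i
  have := memLp_eval_gaussianReal q
  rw [← hl.map_eq] at this
  exact this.comp_of_map hl.aemeasurable

/-- Second moment bound for martingale transforms of centered polynomials of the increments. -/
lemma integral_sum_mul_eval_sq_le [IsProbabilityMeasure P] (hXm : ∀ t, Measurable (X t))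
    (hX : IsBrownianReal X P) {h : ℝ≥0} (hh : 0 < h) {q : ℕ → Polynomial ℝ}
    (hq : ∀ i, ∫ x, (q i).eval x ∂(gaussianReal 0 1) = 0) {Q : ℝ}
    (hQ : ∀ i, ∫ x, (q i).eval x ^ 2 ∂(gaussianReal 0 1) ≤ Q)
    {w : ℕ → Ω → ℝ} (hw : ∀ i : ℕ, Measurable[past X (i * h)] (w i))
    (hw2 : ∀ i, MemLp (w i) 2 P) (N : ℕ) :
    MemLp (fun ω => ∑ i ∈ Finset.range N, w i ω * (q i).eval (normIncr X h i ω)) 2 P ∧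
    ∫ ω, (∑ i ∈ Finset.range N, w i ω * (q i).eval (normIncr X h i ω)) ^ 2 ∂P ≤
      (∑ i ∈ Finset.range N, ∫ ω, w i ω ^ 2 ∂P) * Q := by
  have hev : ∀ q : Polynomial ℝ, Measurable fun x => q.eval x := fun q => q.continuous.measurable
  have hmono : Monotone fun i : ℕ => past X (i * h) := fun i j hij =>
    past_mono (mul_le_mul_left (by exact_mod_cast hij) h)
  obtain ⟨h1, h2⟩ := integral_sum_mul_sq (m := fun i => past X (i * h)) hmono
    (fun i => past_le hXm _) (fun i => indep_past hX _) hw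
    (fun i => (hev (q i)).comp (measurable_normIncr_past h i))
    (fun i => (hev (q i)).comp (measurable_normIncr_comap h i)) hw2
    (fun i => memLp_eval_normIncr hX hh i (q i))
    (fun i => (integral_comp_normIncr hX hh i (hev _)).trans (hq i)) N
  refine ⟨h1, h2.trans_le ?_⟩
  rw [Finset.sum_mul]
  refine Finset.sum_le_sum fun i _ => ?_
  refine mul_le_mul_of_nonneg_left ?_ (integral_nonneg fun _ => sq_nonneg _)
  refine le_trans (le_of_eq ?_) (hQ i)
  exact integral_comp_normIncr hX hh i ((hev (q i)).pow_const 2)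

end NormalizedIncrements

end WeightedVariation

namespace WeightedVariation

variable {Ω : Type*} {mΩ : MeasurableSpace Ω} {P : Measure Ω}

lemma abs_taylor_le {f : ℝ → ℝ} {M : ℝ≥0} (hfd : Differentiable ℝ f)
    (hf' : LipschitzWith M (deriv f)) (x y : ℝ) :
    |f y - f x - deriv f x * (y - x)| ≤ M * (y - x) ^ 2 := by
  have key : ∀ u v : ℝ, u < v → ∀ z ∈ Set.Icc u v,
      |f v - f u - deriv f z * (v - u)| ≤ M * (v - u) ^ 2 := by
    intro u v huv z hz
    obtain ⟨c, hc, hc'⟩ := exists_deriv_eq_slope f huv hfd.continuous.continuousOn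
      hfd.differentiableOn
    have h1 : f v - f u = deriv f c * (v - u) := by
      rw [hc', div_mul_cancel₀ _ (sub_pos.2 huv).ne']
    rw [h1, ← sub_mul, abs_mul, abs_of_pos (sub_pos.2 huv), sq, ← mul_assoc]
    have h2 := hf'.dist_le_mul c z
    rw [Real.dist_eq, Real.dist_eq] at h2
    refine mul_le_mul_of_nonneg_right (h2.trans ?_) (sub_pos.2 huv).le
    refine mul_le_mul_of_nonneg_left ?_ M.coe_nonneg
    rw [abs_le]
    constructor <;> linarith [hc.1, hc.2, hz.1, hz.2]
  rcases lt_trichotomy x y with h | h | h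
  · exact key x y h x (Set.left_mem_Icc.2 h.le)
  · simp [h]
  · have := key y x h x (Set.right_mem_Icc.2 h.le)
    rw [← abs_neg]
    convert this using 2 <;> ring

lemma two_mul_sum_alternating (g : ℕ → ℝ) (N : ℕ) :
    2 * ∑ i ∈ Finset.range N, (-1) ^ i * g i =
      g 0 - (-1) ^ N * g N + ∑ i ∈ Finset.range N, (-1) ^ i * (g i - g (i + 1)) := by
  induction N with
  | zero => simp
  | succ N ih =>
    rw [Finset.sum_range_succ, Finset.sum_range_succ, mul_add, ih, pow_succ]
    ring

lemma abs_sum_alternating_le {g : ℕ → ℝ} {L : ℝ} (hg : ∀ i, |g i| ≤ L) (N : ℕ) :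
    |∑ i ∈ Finset.range N, (-1) ^ i * g i| ≤
      L + ∑ i ∈ Finset.range N, |g i - g (i + 1)| := by
  have h := congrArg abs (two_mul_sum_alternating g N)
  rw [abs_mul, abs_two] at h
  have h1 : |(-1) ^ N * g N| ≤ L := by simpa [abs_mul] using hg N
  have h2 : |∑ i ∈ Finset.range N, (-1) ^ i * (g i - g (i + 1))| ≤
      ∑ i ∈ Finset.range N, |g i - g (i + 1)| := by
    refine (Finset.abs_sum_le_sum_abs _ _).trans (le_of_eq ?_)
    simp [abs_mul]
  have h3 := abs_add_le (g 0 - (-1) ^ N * g N)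
    (∑ i ∈ Finset.range N, (-1) ^ i * (g i - g (i + 1)))
  have h4 := abs_sub (g 0) ((-1) ^ N * g N)
  have h5 : 0 ≤ ∑ i ∈ Finset.range N, |g i - g (i + 1)| :=
    Finset.sum_nonneg fun _ _ => abs_nonneg _
  linarith [hg 0]

section Sums

variable (X : ℝ≥0 → Ω → ℝ) (p : Polynomial ℝ) (α β γ : ℝ) (f : ℝ → ℝ) (h δ t : ℝ≥0) (ω : Ω)

/-- The weighted sum with mesh `h`, over the increments in `[0, t]`. -/
noncomputable def meshSum : ℝ :=
  √h * (1 / 2) * ∑ i ∈ Finset.range ⌊t / h⌋₊, (f (X (i * h) ω) + f (X ((i + 1 : ℕ) * h) ω)) *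
    (weightPoly p α β γ i).eval (normIncr X h i ω)

/-- The weighted sum with mesh `h` and weights taken at left endpoints. -/
noncomputable def leftSum : ℝ :=
  √h * ∑ i ∈ Finset.range ⌊t / h⌋₊, f (X (i * h) ω) *
    (weightPoly p α β γ i).eval (normIncr X h i ω)

/-- The unweighted sum over the mesh increments with index in `[a, b)`. -/
noncomputable def blockIncr (a b : ℕ) : ℝ :=
  √h * ∑ i ∈ Finset.Ico a b, (weightPoly p α β γ i).eval (normIncr X h i ω)

/-- The weighted sum with weights frozen on blocks of length `δ`. -/
noncomputable def blockSum : ℝ :=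
  ∑ k ∈ Finset.range ⌊t / δ⌋₊, f (X (⌊k * δ / h⌋₊ * h) ω) *
    blockIncr X p α β γ h ω ⌊k * δ / h⌋₊ ⌊(k + 1 : ℕ) * δ / h⌋₊

end Sums

variable {X : ℝ≥0 → Ω → ℝ} {p : Polynomial ℝ} {α β γ : ℝ} {f : ℝ → ℝ} {L M : ℝ≥0}

section Measurability

lemma measurable_meshSum (hXm : ∀ t, Measurable (X t)) (hf : Continuous f) (h t : ℝ≥0) :
    Measurable (meshSum X p α β γ f h t) := by
  refine (Finset.measurable_fun_sum _ fun i _ => ?_).const_mul _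
  exact ((hf.measurable.comp (hXm _)).add (hf.measurable.comp (hXm _))).mul
    ((Polynomial.continuous _).measurable.comp (measurable_normIncr hXm h i))

lemma measurable_leftSum (hXm : ∀ t, Measurable (X t)) (hf : Continuous f) (h t : ℝ≥0) :
    Measurable (leftSum X p α β γ f h t) := by
  refine (Finset.measurable_fun_sum _ fun i _ => ?_).const_mul _
  exact (hf.measurable.comp (hXm _)).mul
    ((Polynomial.continuous _).measurable.comp (measurable_normIncr hXm h i))

lemma measurable_blockIncr (hXm : ∀ t, Measurable (X t)) (h : ℝ≥0) (a b : ℕ) :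
    Measurable fun ω => blockIncr X p α β γ h ω a b := by
  refine (Finset.measurable_fun_sum _ fun i _ => ?_).const_mul _
  exact (Polynomial.continuous _).measurable.comp (measurable_normIncr hXm h i)

lemma measurable_blockSum (hXm : ∀ t, Measurable (X t)) (hf : Continuous f) (h δ t : ℝ≥0) :
    Measurable (blockSum X p α β γ f h δ t) :=
  Finset.measurable_fun_sum _ fun _ _ =>
    (hf.measurable.comp (hXm _)).mul (measurable_blockIncr hXm h _ _)

end Measurability

lemma floor_div_mul_le {h t : ℝ≥0} (hh : 0 < h) : (⌊t / h⌋₊ : ℝ) * h ≤ t := by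
  have : (⌊t / h⌋₊ : ℝ≥0) * h ≤ t := by
    rw [← le_div_iff₀ hh]; exact Nat.floor_le zero_le
  exact_mod_cast this

lemma lt_floor_div_add_one_mul {h t : ℝ≥0} (hh : 0 < h) : (t : ℝ) < (⌊t / h⌋₊ + 1) * h := by
  have : t < (⌊t / h⌋₊ + 1) * h := by
    rw [← div_lt_iff₀ hh]; exact Nat.lt_floor_add_one _
  exact_mod_cast this

variable [IsProbabilityMeasure P]

section TaylorTerms

variable (hXm : ∀ t, Measurable (X t)) (hX : IsBrownianReal X P) (t : ℝ≥0)

include hX hXm in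
lemma eLpNorm_first_order_le (hp : HasCenteredHermiteRankGeTwo p) {g : ℝ → ℝ} (hg : Measurable g)
    (hgL : ∀ x, |g x| ≤ L) : ∃ C, 0 ≤ C ∧ ∀ h : ℝ≥0, 0 < h →
    eLpNorm (fun ω => h / 2 * ∑ i ∈ Finset.range ⌊t / h⌋₊, g (X (i * h) ω) *
      (normIncr X h i ω * (weightPoly p α β γ i).eval (normIncr X h i ω) - γ * (-1) ^ (i + 1)))
      1 P ≤ ENNReal.ofReal (C * √h) := by
  obtain ⟨Q, hQ0, hQ⟩ := exists_bound_weightPoly p α β γ fun q =>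
    ∫ x, (x * q.eval x - ∫ y, y * q.eval y ∂(gaussianReal 0 1)) ^ 2 ∂(gaussianReal 0 1)
  refine ⟨√(t * L ^ 2 * Q), Real.sqrt_nonneg _, fun h hh => ?_⟩
  set N := ⌊t / h⌋₊ with hN
  have hNh : (N : ℝ) * h ≤ t := floor_div_mul_le hh
  have hsq := integral_sum_mul_eval_sq_le (P := P) hXm hX hh
    (q := fun i => Polynomial.X * weightPoly p α β γ i - Polynomial.C (γ * (-1) ^ (i + 1)))
    (Q := Q) (w := fun i ω => g (X (i * h) ω)) ?_ ?_
    (fun i => hg.comp (measurable_past le_rfl)) ?_ N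
  · simp only [Polynomial.eval_sub, Polynomial.eval_mul, Polynomial.eval_X,
      Polynomial.eval_C] at hsq
    obtain ⟨h1, h2⟩ := hsq
    rw [← Real.sqrt_mul (by positivity)]
    refine eLpNorm_one_le_of_integral_sq_le (h1.const_mul _) ?_
    simp_rw [mul_pow]
    rw [integral_const_mul]
    have hsum : ∑ i ∈ Finset.range N, ∫ ω, g (X (i * h) ω) ^ 2 ∂P ≤ N * (L : ℝ) ^ 2 := by
      refine (Finset.sum_le_card_nsmul _ _ ((L : ℝ) ^ 2) fun i _ => ?_).trans_eq (by simp)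
      have hle : ∀ ω, g (X (i * h) ω) ^ 2 ≤ (L : ℝ) ^ 2 := fun ω => by
        rw [← sq_abs]; exact pow_le_pow_left₀ (abs_nonneg _) (hgL _) 2
      refine (integral_mono_of_nonneg (ae_of_all _ fun _ => sq_nonneg _)
        (integrable_const ((L : ℝ) ^ 2)) (ae_of_all _ hle)).trans_eq (by simp)
    calc ((h : ℝ) / 2) ^ 2 * _ ≤ (h / 2) ^ 2 * ((N * L ^ 2) * Q) := by
          gcongr
          exact h2.trans (by gcongr)
      _ = (N * h) * (L ^ 2 * Q * h / 4) := by ring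
      _ ≤ t * (L ^ 2 * Q * h / 4) := by gcongr
      _ ≤ t * (L ^ 2 * Q * h / 1) := by gcongr; norm_num
      _ = _ := by ring
  · intro i
    have hint : Integrable (fun x => x * (weightPoly p α β γ i).eval x) (gaussianReal 0 1) :=
      integrable_gaussianReal_of_eq_eval (Polynomial.X * weightPoly p α β γ i) (by simp)
    simp only [Polynomial.eval_sub, Polynomial.eval_mul, Polynomial.eval_X, Polynomial.eval_C]
    rw [integral_sub hint (integrable_const _), integral_mul_weightPoly hp]
    simp
  · intro i
    have := hQ i
    simp only [integral_mul_weightPoly hp] at this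
    simpa using this
  · intro i
    exact MemLp.of_bound (hg.comp (hXm _)).aestronglyMeasurable L (ae_of_all _ fun ω => hgL _)

include hX in
lemma eLpNorm_alternating_le {g : ℝ → ℝ} (hgL : ∀ x, |g x| ≤ L) (hgM : LipschitzWith M g) :
    ∃ C, 0 ≤ C ∧ ∀ h : ℝ≥0, 0 < h → h ≤ 1 →
    eLpNorm (fun ω => h / 2 * ∑ i ∈ Finset.range ⌊t / h⌋₊, g (X (i * h) ω) *
      (γ * (-1) ^ (i + 1))) 1 P ≤ ENNReal.ofReal (C * √h) := by
  refine ⟨|γ| * (L + M * (2 * t)), by positivity, fun h hh h1 => ?_⟩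
  set N := ⌊t / h⌋₊ with hN
  have hNh : (N : ℝ) * h ≤ t := floor_div_mul_le hh
  have hsh : 0 < √(h : ℝ) := Real.sqrt_pos.2 (by exact_mod_cast hh)
  have hsq : √(h : ℝ) * √h = h := Real.mul_self_sqrt h.coe_nonneg
  have hs1 : √(h : ℝ) ≤ 1 := Real.sqrt_le_one.2 (by exact_mod_cast h1)
  have hint : ∀ i, Integrable (fun ω => 1 + normIncr X h i ω ^ 2) P := fun i => by
    have := integrable_eval_normIncr hX hh i (1 + Polynomial.X ^ 2)
    exact this.congr (ae_of_all _ fun ω => by simp)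
  have hval : ∀ i, ∫ ω, (1 + normIncr X h i ω ^ 2) ∂P = 2 := fun i => by
    rw [integral_comp_normIncr hX hh i (g := fun x => 1 + x ^ 2) (by fun_prop),
      integral_add (integrable_const _)
        (integrable_gaussianReal_of_eq_eval (Polynomial.X ^ 2) (by simp)),
      integral_sq_gaussianReal]
    norm_num
  have hbd : ∀ ω, ‖(h : ℝ) / 2 * ∑ i ∈ Finset.range N, g (X (i * h) ω) * (γ * (-1) ^ (i + 1))‖ ≤
      |γ| * h * (L + ∑ i ∈ Finset.range N, M * √h * (1 + normIncr X h i ω ^ 2)) := by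
    intro ω
    have e1 : ∑ i ∈ Finset.range N, g (X (i * h) ω) * (γ * (-1) ^ (i + 1)) =
        -γ * ∑ i ∈ Finset.range N, (-1) ^ i * g (X (i * h) ω) := by
      rw [Finset.mul_sum]
      exact Finset.sum_congr rfl fun i _ => by ring
    rw [e1, Real.norm_eq_abs, abs_mul, abs_mul, abs_neg, abs_of_nonneg (by positivity)]
    have e2 := abs_sum_alternating_le (g := fun i : ℕ => g (X (i * h) ω)) (fun i => hgL _) N
    have e3 : ∑ i ∈ Finset.range N, |g (X (i * h) ω) - g (X ((i + 1 : ℕ) * h) ω)| ≤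
        ∑ i ∈ Finset.range N, M * √h * (1 + normIncr X h i ω ^ 2) := by
      refine Finset.sum_le_sum fun i _ => ?_
      have e4 := hgM.dist_le_mul (X (i * h) ω) (X ((i + 1 : ℕ) * h) ω)
      rw [Real.dist_eq, Real.dist_eq, abs_sub_comm (X (i * h) ω)] at e4
      have e5 : X ((i + 1 : ℕ) * h) ω - X (i * h) ω = √h * normIncr X h i ω := by
        rw [normIncr, mul_div_cancel₀ _ hsh.ne']
      rw [e5, abs_mul, abs_of_pos hsh] at e4
      refine e4.trans ?_
      rw [← mul_assoc]
      refine mul_le_mul_of_nonneg_left ?_ (by positivity)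
      rw [← sq_abs]
      nlinarith [sq_nonneg (|normIncr X h i ω| - 1)]
    have e6 : |∑ i ∈ Finset.range N, (-1) ^ i * g (X (i * h) ω)| ≤
        L + ∑ i ∈ Finset.range N, M * √h * (1 + normIncr X h i ω ^ 2) := by linarith
    calc (h : ℝ) / 2 * (|γ| * _) ≤ h / 1 * (|γ| * _) := by gcongr; norm_num
      _ ≤ h / 1 * (|γ| * (L + ∑ i ∈ Finset.range N, M * √h * (1 + normIncr X h i ω ^ 2))) := by
        gcongr
      _ = _ := by ring
  refine (eLpNorm_mono_real hbd).trans ?_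
  have hsumint : Integrable
      (fun ω => ∑ i ∈ Finset.range N, M * √h * (1 + normIncr X h i ω ^ 2)) P :=
    integrable_finsetSum _ fun i _ => (hint i).const_mul _
  refine eLpNorm_one_le_of_integral_abs_le
    (((integrable_const (L : ℝ)).add hsumint).const_mul (|γ| * h)) ?_
  have habs : ∀ ω, |(|γ| * h * (L + ∑ i ∈ Finset.range N, M * √h * (1 + normIncr X h i ω ^ 2)))| =
      |γ| * h * (L + ∑ i ∈ Finset.range N, M * √h * (1 + normIncr X h i ω ^ 2)) := fun ω =>
    abs_of_nonneg ((norm_nonneg _).trans (hbd ω))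
  refine (integral_congr_ae (ae_of_all _ habs)).trans_le ?_
  rw [integral_const_mul, integral_add (integrable_const _) hsumint,
    integral_finsetSum _ fun i _ => (hint i).const_mul _]
  simp_rw [integral_const_mul, hval]
  simp only [integral_const, probReal_univ, smul_eq_mul, one_mul, Finset.sum_const,
    Finset.card_range, nsmul_eq_mul]
  have e7 : (h : ℝ) ≤ √h := by
    calc (h : ℝ) = √h * √h := hsq.symm
      _ ≤ √h * 1 := by gcongr
      _ = √h := mul_one _
  calc |γ| * h * (L + N * (M * √h * 2)) = |γ| * (L * h + M * (2 * (N * h)) * √h) := by ring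
    _ ≤ |γ| * (L * √h + M * (2 * t) * √h) := by gcongr
    _ = _ := by ring

omit [IsProbabilityMeasure P] in
include hX in
lemma eLpNorm_remainder_le (hfd : Differentiable ℝ f) (hf' : LipschitzWith M (deriv f)) :
    ∃ C, 0 ≤ C ∧ ∀ h : ℝ≥0, 0 < h →
    eLpNorm (fun ω => √h / 2 * ∑ i ∈ Finset.range ⌊t / h⌋₊,
      (f (X ((i + 1 : ℕ) * h) ω) - f (X (i * h) ω) -
        deriv f (X (i * h) ω) * (X ((i + 1 : ℕ) * h) ω - X (i * h) ω)) *
      (weightPoly p α β γ i).eval (normIncr X h i ω)) 1 P ≤ ENNReal.ofReal (C * √h) := by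
  obtain ⟨Q, hQ0, hQ⟩ := exists_bound_weightPoly p α β γ fun q =>
    ∫ x, (Polynomial.X ^ 2 * (1 + q ^ 2)).eval x ∂(gaussianReal 0 1)
  refine ⟨M * t * Q, by positivity, fun h hh => ?_⟩
  set N := ⌊t / h⌋₊ with hN
  have hNh : (N : ℝ) * h ≤ t := floor_div_mul_le hh
  have hsh : 0 < √(h : ℝ) := Real.sqrt_pos.2 (by exact_mod_cast hh)
  have hsq : √(h : ℝ) ^ 2 = h := Real.sq_sqrt h.coe_nonneg
  set r : ℕ → Polynomial ℝ := fun i => Polynomial.X ^ 2 * (1 + weightPoly p α β γ i ^ 2) with hr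
  have hbd : ∀ ω, ‖√(h : ℝ) / 2 * ∑ i ∈ Finset.range N,
      (f (X ((i + 1 : ℕ) * h) ω) - f (X (i * h) ω) -
        deriv f (X (i * h) ω) * (X ((i + 1 : ℕ) * h) ω - X (i * h) ω)) *
      (weightPoly p α β γ i).eval (normIncr X h i ω)‖ ≤
      M * h * √h * ∑ i ∈ Finset.range N, (r i).eval (normIncr X h i ω) := by
    intro ω
    rw [norm_mul, Real.norm_of_nonneg (by positivity)]
    have e0 : ‖∑ i ∈ Finset.range N,
      (f (X ((i + 1 : ℕ) * h) ω) - f (X (i * h) ω) -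
        deriv f (X (i * h) ω) * (X ((i + 1 : ℕ) * h) ω - X (i * h) ω)) *
      (weightPoly p α β γ i).eval (normIncr X h i ω)‖ ≤
        ∑ i ∈ Finset.range N, M * h * (r i).eval (normIncr X h i ω) := by
      refine (norm_sum_le _ _).trans (Finset.sum_le_sum fun i _ => ?_)
      have e1 := abs_taylor_le hfd hf' (X (i * h) ω) (X ((i + 1 : ℕ) * h) ω)
      have e5 : X ((i + 1 : ℕ) * h) ω - X (i * h) ω = √h * normIncr X h i ω := by
        rw [normIncr, mul_div_cancel₀ _ hsh.ne']
      rw [norm_mul, Real.norm_eq_abs, Real.norm_eq_abs]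
      rw [e5, mul_pow, hsq] at e1
      rw [e5]
      set z := (weightPoly p α β γ i).eval (normIncr X h i ω) with hz
      have e2 : |z| ≤ 1 + z ^ 2 := by
        rw [← sq_abs]; nlinarith [sq_nonneg (|z| - 1)]
      calc _ ≤ (M * (h * normIncr X h i ω ^ 2)) * (1 + z ^ 2) := by gcongr
        _ = _ := by simp [hr, hz]; ring
    rw [← Finset.mul_sum] at e0
    have e3 : 0 ≤ ∑ i ∈ Finset.range N, (r i).eval (normIncr X h i ω) :=
      Finset.sum_nonneg fun i _ => by simp only [hr]; simp; positivity
    calc _ ≤ √(h : ℝ) / 1 * (M * h * ∑ i ∈ Finset.range N, (r i).eval (normIncr X h i ω)) := by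
          gcongr; norm_num
      _ = _ := by ring
  refine (eLpNorm_mono_real hbd).trans ?_
  have hint := fun i => integrable_eval_normIncr hX hh i (r i)
  refine eLpNorm_one_le_of_integral_abs_le
    ((integrable_finsetSum _ fun i _ => hint i).const_mul _) ?_
  simp_rw [fun ω => abs_of_nonneg ((norm_nonneg _).trans (hbd ω))]
  rw [integral_const_mul, integral_finsetSum _ fun i _ => hint i]
  have hsum : ∑ i ∈ Finset.range N, ∫ ω, (r i).eval (normIncr X h i ω) ∂P ≤ N * Q := by
    refine (Finset.sum_le_card_nsmul _ _ Q fun i _ => ?_).trans_eq (by simp)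
    refine le_trans (le_of_eq ?_) (hQ i)
    exact integral_comp_normIncr hX hh i (g := fun x => (r i).eval x)
      (Polynomial.continuous _).measurable
  calc M * h * √h * _ ≤ M * h * √h * (N * Q) := by gcongr
    _ = M * (N * h) * Q * √h := by ring
    _ ≤ _ := by gcongr

include hX hXm in
lemma eLpNorm_meshSum_sub_leftSum_le (hp : HasCenteredHermiteRankGeTwo p)
    (hf : LipschitzWith L f) (hfd : Differentiable ℝ f) (hf' : LipschitzWith M (deriv f)) :
    ∃ C, 0 ≤ C ∧ ∀ h : ℝ≥0, 0 < h → h ≤ 1 →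
    eLpNorm (fun ω => meshSum X p α β γ f h t ω - leftSum X p α β γ f h t ω) 1 P ≤
      ENNReal.ofReal (C * √h) := by
  have hdm : Measurable (deriv f) := hf'.continuous.measurable
  have hdL : ∀ x, |deriv f x| ≤ L := fun x => norm_deriv_le_of_lipschitz hf
  obtain ⟨C₁, hC₁, H₁⟩ := eLpNorm_first_order_le (α := α) (β := β) (γ := γ) hXm hX t hp hdm hdL
  obtain ⟨C₂, hC₂, H₂⟩ := eLpNorm_alternating_le (γ := γ) hX t hdL hf'
  obtain ⟨C₃, hC₃, H₃⟩ := eLpNorm_remainder_le (p := p) (α := α) (β := β) (γ := γ) hX t hfd hf'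
  refine ⟨C₁ + C₂ + C₃, by positivity, fun h hh h1 => ?_⟩
  have hsh : 0 < √(h : ℝ) := Real.sqrt_pos.2 (by exact_mod_cast hh)
  have hsq : √(h : ℝ) ^ 2 = h := Real.sq_sqrt h.coe_nonneg
  have hev : ∀ i, Measurable fun ω => (weightPoly p α β γ i).eval (normIncr X h i ω) := fun i =>
    (Polynomial.continuous _).measurable.comp (measurable_normIncr hXm h i)
  have hfm := hf.continuous.measurable
  have hξ := measurable_normIncr hXm h
  set A₁ : Ω → ℝ := fun ω => h / 2 * ∑ i ∈ Finset.range ⌊t / h⌋₊, deriv f (X (i * h) ω) *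
      (normIncr X h i ω * (weightPoly p α β γ i).eval (normIncr X h i ω) - γ * (-1) ^ (i + 1))
    with hA₁
  set A₂ : Ω → ℝ := fun ω => h / 2 * ∑ i ∈ Finset.range ⌊t / h⌋₊, deriv f (X (i * h) ω) *
      (γ * (-1) ^ (i + 1)) with hA₂
  set A₃ : Ω → ℝ := fun ω => √h / 2 * ∑ i ∈ Finset.range ⌊t / h⌋₊,
      (f (X ((i + 1 : ℕ) * h) ω) - f (X (i * h) ω) -
        deriv f (X (i * h) ω) * (X ((i + 1 : ℕ) * h) ω - X (i * h) ω)) *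
      (weightPoly p α β γ i).eval (normIncr X h i ω) with hA₃
  have hm₁ : Measurable A₁ := (Finset.measurable_fun_sum _ fun i _ =>
    (hdm.comp (hXm _)).mul (((hξ i).mul (hev i)).sub_const _)).const_mul _
  have hm₂ : Measurable A₂ := (Finset.measurable_fun_sum _ fun i _ =>
    (hdm.comp (hXm _)).mul_const _).const_mul _
  have hm₃ : Measurable A₃ := (Finset.measurable_fun_sum _ fun i _ =>
    (((hfm.comp (hXm _)).sub (hfm.comp (hXm _))).sub
      ((hdm.comp (hXm _)).mul ((hXm _).sub (hXm _)))).mul (hev i)).const_mul _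
  have hdecomp : (fun ω => meshSum X p α β γ f h t ω - leftSum X p α β γ f h t ω) =
      A₁ + A₂ + A₃ := by
    funext ω
    simp only [Pi.add_apply, hA₁, hA₂, hA₃, meshSum, leftSum, Finset.mul_sum]
    rw [← Finset.sum_sub_distrib, ← Finset.sum_add_distrib, ← Finset.sum_add_distrib]
    refine Finset.sum_congr rfl fun i _ => ?_
    have e5 : X ((i + 1 : ℕ) * h) ω - X (i * h) ω = √h * normIncr X h i ω := by
      rw [normIncr, mul_div_cancel₀ _ hsh.ne']
    rw [e5]
    linear_combination (-(1 / 2) * deriv f (X (i * h) ω) * normIncr X h i ω *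
      (weightPoly p α β γ i).eval (normIncr X h i ω)) * hsq * (-1)
  rw [hdecomp, add_mul, add_mul, ENNReal.ofReal_add (by positivity) (by positivity),
    ENNReal.ofReal_add (by positivity) (by positivity)]
  refine (eLpNorm_add_le (hm₁.add hm₂).aestronglyMeasurable hm₃.aestronglyMeasurable le_rfl).trans
    (add_le_add ?_ (H₃ h hh))
  exact (eLpNorm_add_le hm₁.aestronglyMeasurable hm₂.aestronglyMeasurable le_rfl).trans
    (add_le_add (H₁ h hh) (H₂ h hh h1))

end TaylorTerms

section Blocks

@[to_additive]
lemma prod_range_eq_prod_Ico {A : Type*} [CommMonoid A] {a : ℕ → ℕ} (ha : Monotone a)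
    (ha0 : a 0 = 0) (G : ℕ → A) (K : ℕ) :
    ∏ i ∈ Finset.range (a K), G i =
      ∏ k ∈ Finset.range K, ∏ i ∈ Finset.Ico (a k) (a (k + 1)), G i := by
  induction K with
  | zero => simp [ha0]
  | succ K ih =>
    rw [Finset.prod_range_succ, ← ih, Finset.range_eq_Ico, Finset.range_eq_Ico,
      Finset.prod_Ico_consecutive _ (Nat.zero_le _) (ha (Nat.le_succ K))]

/-- The index `k ≤ K` of the block `[a k, a (k + 1))` that contains `i`. -/
def blockIndex (a : ℕ → ℕ) (K i : ℕ) : ℕ := Nat.findGreatest (fun k => a k ≤ i) K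

lemma blockIndex_eq {a : ℕ → ℕ} (ha : Monotone a) {K k i : ℕ} (hk : k ≤ K) (h1 : a k ≤ i)
    (h2 : i < a (k + 1)) : blockIndex a K i = k := by
  refine (Nat.findGreatest_eq_iff).2 ⟨hk, fun _ => h1, fun n hn _ hni => ?_⟩
  exact absurd (h2.trans_le ((ha hn).trans hni)) (lt_irrefl _)

lemma blockIndex_spec {a : ℕ → ℕ} (ha0 : a 0 = 0) (K i : ℕ) : a (blockIndex a K i) ≤ i :=
  Nat.findGreatest_spec (P := fun k => a k ≤ i) (Nat.zero_le K) (by simp [ha0])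

lemma lt_blockIndex_succ {a : ℕ → ℕ} (ha0 : a 0 = 0) {K i : ℕ} (hi : i < a K) :
    blockIndex a K i < K ∧ i < a (blockIndex a K i + 1) := by
  have hlt : blockIndex a K i < K := by
    refine lt_of_le_of_ne (Nat.findGreatest_le K) fun h => ?_
    have := blockIndex_spec ha0 K i
    rw [h] at this
    exact absurd hi (not_lt.2 this)
  refine ⟨hlt, not_le.1 ?_⟩
  exact Nat.findGreatest_is_greatest (P := fun k => a k ≤ i) (Nat.lt_succ_self _) hlt

lemma monotone_blockBound (h δ : ℝ≥0) : Monotone fun k : ℕ => ⌊k * δ / h⌋₊ := fun k l hkl =>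
  Nat.floor_mono (by gcongr)

lemma leftSum_sub_blockSum (h δ t : ℝ≥0) (hh : 0 < h) (hδ : 0 < δ) (ω : Ω) :
    leftSum X p α β γ f h t ω - blockSum X p α β γ f h δ t ω =
      √h * ∑ i ∈ Finset.range ⌊t / h⌋₊, (f (X (i * h) ω) -
        if i < ⌊(⌊t / δ⌋₊ : ℕ) * δ / h⌋₊ then
          f (X (⌊blockIndex (fun k => ⌊k * δ / h⌋₊) ⌊t / δ⌋₊ i * δ / h⌋₊ * h) ω) else 0) *
        (weightPoly p α β γ i).eval (normIncr X h i ω) := by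
  set a : ℕ → ℕ := fun k => ⌊k * δ / h⌋₊ with ha
  set K := ⌊t / δ⌋₊ with hK
  have hmono : Monotone a := monotone_blockBound h δ
  have ha0 : a 0 = 0 := by simp [ha]
  have haN : a K ≤ ⌊t / h⌋₊ := by
    refine Nat.floor_mono ?_
    gcongr
    rw [← le_div_iff₀ hδ]
    exact Nat.floor_le zero_le
  have key : ∑ i ∈ Finset.range ⌊t / h⌋₊,
      (if i < a K then f (X (a (blockIndex a K i) * h) ω) else 0) *
        (weightPoly p α β γ i).eval (normIncr X h i ω) =
      ∑ k ∈ Finset.range K, ∑ i ∈ Finset.Ico (a k) (a (k + 1)), f (X (a k * h) ω) *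
        (weightPoly p α β γ i).eval (normIncr X h i ω) := by
    rw [← Finset.sum_subset (Finset.range_subset_range.2 haN)]
    · rw [sum_range_eq_sum_Ico hmono ha0]
      refine Finset.sum_congr rfl fun k hk => Finset.sum_congr rfl fun i hi => ?_
      have hkK := Finset.mem_range.1 hk
      obtain ⟨h1, h2⟩ := Finset.mem_Ico.1 hi
      rw [if_pos (h2.trans_le (hmono hkK)), blockIndex_eq hmono hkK.le h1 h2]
    · intro i _ hi
      rw [if_neg (by simpa using hi), zero_mul]
  simp only [sub_mul]
  rw [Finset.sum_sub_distrib, key, mul_sub, leftSum, blockSum]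
  congr 1
  rw [Finset.mul_sum]
  refine Finset.sum_congr rfl fun k _ => ?_
  rw [blockIncr, ← Finset.mul_sum]
  ring

lemma eLpNorm_leftSum_sub_blockSum_le (hXm : ∀ t, Measurable (X t)) (hX : IsBrownianReal X P)
    (t : ℝ≥0) (hf : LipschitzWith L f) :
    ∃ C, 0 ≤ C ∧ ∀ δ h : ℝ≥0, 0 < h → h ≤ δ →
    eLpNorm (fun ω => leftSum X p α β γ f h t ω - blockSum X p α β γ f h δ t ω) 1 P ≤
      ENNReal.ofReal (C * √δ) := by
  obtain ⟨Q, hQ0, hQ⟩ := exists_bound_weightPoly p α β γ fun q =>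
    ∫ x, q.eval x ^ 2 ∂(gaussianReal 0 1)
  set D : ℝ := 2 * f 0 ^ 2 + 2 * L ^ 2 * t with hD
  have hD0 : 0 ≤ D := by positivity
  refine ⟨√((t * L ^ 2 + 2 * D) * Q), Real.sqrt_nonneg _, fun δ h hh hhδ => ?_⟩
  have hδ : 0 < δ := hh.trans_le hhδ
  simp_rw [leftSum_sub_blockSum h δ t hh hδ]
  set a : ℕ → ℕ := fun k => ⌊k * δ / h⌋₊ with ha
  set K := ⌊t / δ⌋₊ with hK
  set N := ⌊t / h⌋₊ with hN
  have hmono : Monotone a := monotone_blockBound h δ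
  have ha0 : a 0 = 0 := by simp [ha]
  have hNh : (N : ℝ) * h ≤ t := floor_div_mul_le hh
  have haK : (K * δ : ℝ) < (a K + 1) * h := by
    simpa using lt_floor_div_add_one_mul (t := K * δ) hh
  have hKt : (t : ℝ) < (K + 1) * δ := lt_floor_div_add_one_mul hδ
  set w : ℕ → Ω → ℝ := fun i ω => f (X (i * h) ω) -
    if i < a K then f (X (a (blockIndex a K i) * h) ω) else 0 with hw
  have hwm : ∀ i : ℕ, Measurable[past X (i * h)] (w i) := by
    intro i
    have hfm := hf.continuous.measurable
    by_cases hi : i < a K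
    · simp only [hw, hi, if_true]
      refine (hfm.comp (measurable_past le_rfl)).sub (hfm.comp (measurable_past ?_))
      exact mul_le_mul_left (by exact_mod_cast blockIndex_spec ha0 K i) h
    · simp only [hw, hi, if_false, sub_zero]
      exact hfm.comp (measurable_past le_rfl)
  have hw2 : ∀ i, MemLp (w i) 2 P := by
    intro i
    by_cases hi : i < a K
    · simp only [hw, hi, if_true]
      exact (memLp_comp_brownian hX hf _).sub (memLp_comp_brownian hX hf _)
    · simp only [hw, hi, if_false, sub_zero]
      exact memLp_comp_brownian hX hf _
  have hwb : ∀ i ∈ Finset.range N, ∫ ω, w i ω ^ 2 ∂P ≤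
      L ^ 2 * δ + if i < a K then 0 else D := by
    intro i hi
    have hiN : (i : ℝ≥0) * h ≤ t := by
      have : (i : ℝ) * h ≤ N * h := by
        gcongr
        exact_mod_cast (Finset.mem_range.1 hi).le
      exact_mod_cast this.trans hNh
    by_cases hi : i < a K
    · simp only [hw, hi, if_true, add_zero]
      refine (integral_comp_brownian_sub_sq_le hX hf _ _).trans ?_
      gcongr
      obtain ⟨_, hi2⟩ := lt_blockIndex_succ ha0 hi
      have hi1 := blockIndex_spec ha0 K i
      set k := blockIndex a K i with hk
      have e1 : ((i : ℝ) + 1) * h ≤ (k + 1) * δ := by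
        have e2 : ((a (k + 1) : ℕ) : ℝ) * h ≤ (k + 1) * δ := by
          simpa [ha] using floor_div_mul_le (t := (k + 1 : ℕ) * δ) hh
        have e3 : ((i : ℝ) + 1) * h ≤ (a (k + 1) : ℕ) * h := by
          gcongr
          exact_mod_cast hi2
        exact e3.trans e2
      have e4 : (k * δ : ℝ) < (a k + 1) * h := by
        simpa using lt_floor_div_add_one_mul (t := k * δ) hh
      have e5 : (a k : ℝ) * h ≤ i * h := by
        gcongr
      push_cast
      rw [abs_of_nonneg (by linarith)]
      linarith
    · simp only [hw, hi, if_false, sub_zero]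
      have := integral_comp_brownian_sq_le hX hf hiN
      have h0 : 0 ≤ (L : ℝ) ^ 2 * δ := by positivity
      linarith
  obtain ⟨h1, h2⟩ := integral_sum_mul_eval_sq_le (P := P) hXm hX hh
    (q := weightPoly p α β γ) integral_weightPoly hQ hwm hw2 N
  rw [← Real.sqrt_mul (by positivity)]
  refine eLpNorm_one_le_of_integral_sq_le (h1.const_mul _) ?_
  simp_rw [mul_pow]
  rw [integral_const_mul, Real.sq_sqrt h.coe_nonneg]
  have hsum : ∑ i ∈ Finset.range N, ∫ ω, w i ω ^ 2 ∂P ≤ N * (L ^ 2 * δ) + (N - a K : ℕ) * D := by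
    refine (Finset.sum_le_sum hwb).trans (le_of_eq ?_)
    rw [Finset.sum_add_distrib, Finset.sum_const, Finset.card_range, nsmul_eq_mul]
    congr 1
    rw [Finset.sum_ite, Finset.sum_const_zero, zero_add, Finset.sum_const, nsmul_eq_mul]
    congr 2
    have : (Finset.range N).filter (fun i => ¬ i < a K) = Finset.Ico (a K) N := by
      ext i
      simp only [Finset.mem_filter, Finset.mem_range, Finset.mem_Ico]
      lia
    rw [this, Nat.card_Ico]
  have hNa : ((N - a K : ℕ) : ℝ) * h ≤ 2 * δ := by
    have hhδ' : (h : ℝ) ≤ δ := by exact_mod_cast hhδ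
    rcases le_total (a K) N with hle | hle
    · rw [Nat.cast_sub hle]
      linarith
    · rw [Nat.sub_eq_zero_of_le hle]
      simp
  calc (h : ℝ) * ∫ ω, (∑ i ∈ Finset.range N, w i ω * _) ^ 2 ∂P
      ≤ h * ((N * (L ^ 2 * δ) + (N - a K : ℕ) * D) * Q) := by
        gcongr
        exact h2.trans (by gcongr)
    _ = ((N * h) * (L ^ 2 * δ) + ((N - a K : ℕ) * h) * D) * Q := by ring
    _ ≤ (t * (L ^ 2 * δ) + (2 * δ) * D) * Q := by gcongr
    _ = _ := by ring

/-- The blocked sums approximate the weighted sums in `L¹`, uniformly in the mesh. -/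
lemma eLpNorm_meshSum_sub_blockSum_le (hXm : ∀ t, Measurable (X t)) (hX : IsBrownianReal X P)
    (t : ℝ≥0) (hp : HasCenteredHermiteRankGeTwo p)
    (hf : LipschitzWith L f) (hfd : Differentiable ℝ f) (hf' : LipschitzWith M (deriv f)) :
    ∃ C, 0 ≤ C ∧ ∀ δ h : ℝ≥0, 0 < h → h ≤ δ → δ ≤ 1 →
    eLpNorm (fun ω => meshSum X p α β γ f h t ω - blockSum X p α β γ f h δ t ω) 1 P ≤
      ENNReal.ofReal (C * √δ) := by
  obtain ⟨C₁, hC₁, H₁⟩ := eLpNorm_meshSum_sub_leftSum_le (p := p) (α := α) (β := β) (γ := γ)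
    hXm hX t hp hf hfd hf'
  obtain ⟨C₂, hC₂, H₂⟩ := eLpNorm_leftSum_sub_blockSum_le (p := p) (α := α) (β := β) (γ := γ)
    hXm hX t hf
  refine ⟨C₁ + C₂, by positivity, fun δ h hh hδ h1 => ?_⟩
  rw [add_mul, ENNReal.ofReal_add (by positivity) (by positivity)]
  refine (eLpNorm_fun_sub_le le_rfl
    (measurable_meshSum hXm hf.continuous h t).aestronglyMeasurable
    (measurable_leftSum hXm hf.continuous h t).aestronglyMeasurable
    (measurable_blockSum hXm hf.continuous h δ t).aestronglyMeasurable).trans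
    (add_le_add ((H₁ h hh (hδ.trans h1)).trans ?_) (H₂ δ h hh hδ))
  gcongr

end Blocks

end WeightedVariation

namespace WeightedVariation

variable {Ω : Type*} {mΩ : MeasurableSpace Ω} {P : Measure Ω} [IsProbabilityMeasure P]
  {X B : ℝ≥0 → Ω → ℝ} {p : Polynomial ℝ} {α β γ : ℝ}

lemma monotone_cast_mul (h : ℝ≥0) : Monotone fun i : ℕ => (i : ℝ≥0) * h := fun i j hij =>
  mul_le_mul_left (by exact_mod_cast hij) h

omit [IsProbabilityMeasure P] in
lemma iIndepFun_normIncr (hX : IsBrownianReal X P) (h : ℝ≥0) : iIndepFun (normIncr X h) P :=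
  (hX.hasIndepIncrements.nat (monotone_cast_mul h)).comp (fun _ x => x / √h) (by fun_prop)

omit [IsProbabilityMeasure P] in
lemma charFun_sum_comp_normIncr (hXm : ∀ t, Measurable (X t)) (hX : IsBrownianReal X P)
    {h : ℝ≥0} (hh : 0 < h) {G : ℕ → ℝ → ℝ} (hG : ∀ i, Measurable (G i)) (N : ℕ) (r : ℝ) :
    charFun (P.map fun ω => ∑ i ∈ Finset.range N, G i (normIncr X h i ω)) r =
      ∏ i ∈ Finset.range N, charFun ((gaussianReal 0 1).map (G i)) r := by
  have hind : iIndepFun (fun i ω => G i (normIncr X h i ω)) P :=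
    (iIndepFun_normIncr hX h).comp G hG
  have hm : ∀ i ∈ Finset.range N, AEMeasurable (fun ω => G i (normIncr X h i ω)) P :=
    fun i _ => ((hG i).comp (measurable_normIncr hXm h i)).aemeasurable
  rw [(hind.restrict _).charFun_map_fun_finsetSum_eq_prod hm, Finset.prod_apply]
  refine Finset.prod_congr rfl fun i _ => ?_
  rw [← (hasLaw_normIncr hX hh i).map_eq, Measure.map_map (hG i) (measurable_normIncr hXm h i)]
  rfl

omit mΩ in
lemma increment_eq_sqrt_mul {h : ℝ≥0} (hh : 0 < h) (i : ℕ) (ω : Ω) :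
    X ((i + 1 : ℕ) * h) ω - X (i * h) ω = √h * normIncr X h i ω := by
  have hsh : 0 < √(h : ℝ) := Real.sqrt_pos.2 (by exact_mod_cast hh)
  rw [normIncr, mul_div_cancel₀ _ hsh.ne']

omit mΩ in
lemma increment_eq_sqrt_mul_sum {h : ℝ≥0} (hh : 0 < h) {a b : ℕ} (hab : a ≤ b) (ω : Ω) :
    X (b * h) ω - X (a * h) ω = √h * ∑ i ∈ Finset.Ico a b, normIncr X h i ω := by
  rw [Finset.mul_sum, ← Finset.sum_Ico_sub (fun i : ℕ => X (i * h) ω) hab]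
  exact Finset.sum_congr rfl fun i _ => increment_eq_sqrt_mul hh i ω

omit [IsProbabilityMeasure P] in
lemma charFun_sum_increments (hXm : ∀ t, Measurable (X t)) (hX : IsBrownianReal X P)
    {δ : ℝ≥0} (hδ : 0 < δ) (c : ℕ → ℝ) (K : ℕ) :
    charFun (P.map fun ω => ∑ k ∈ Finset.range K,
      c k * (X ((k + 1 : ℕ) * δ) ω - X (k * δ) ω)) 1 =
      ∏ k ∈ Finset.range K, Complex.exp (-(c k ^ 2 * δ / 2 : ℝ)) := by
  have h1 := charFun_sum_comp_normIncr hXm hX hδ (G := fun k x => c k * √δ * x)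
    (fun k => by fun_prop) K 1
  simp_rw [increment_eq_sqrt_mul hδ, ← mul_assoc]
  rw [h1]
  refine Finset.prod_congr rfl fun k _ => ?_
  have h2 := charFun_map_mul_comp (μ := gaussianReal 0 1) (f := id) (by fun_prop)
    (c k * √δ) 1
  simp only [id_eq] at h2
  rw [h2, Measure.map_id, charFun_gaussianReal]
  congr 1
  have hsq : (√(δ : ℝ) : ℂ) ^ 2 = (δ : ℝ) := by
    rw [← Complex.ofReal_pow, Real.sq_sqrt δ.coe_nonneg]
  push_cast
  rw [mul_one, mul_pow, hsq]
  ring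

/-- The variance of the limit, per unit of time. -/
noncomputable def limitVar (p : Polynomial ℝ) (α β γ : ℝ) : ℝ :=
  γ ^ 2 + (α ^ 2 + β ^ 2) / 2 * gaussianVar p

lemma limitVar_nonneg (p : Polynomial ℝ) (α β γ : ℝ) : 0 ≤ limitVar p α β γ := by
  have : 0 ≤ gaussianVar p := variance_nonneg _ _
  unfold limitVar
  positivity

lemma charFun_limit_increments (hXm : ∀ t, Measurable (X t)) (hBm : ∀ t, Measurable (B t))
    (hX : IsBrownianReal X P) (hB : IsBrownianReal B P)
    (hXB : IndepFun (fun ω t => X t ω) (fun ω t => B t ω) P) {δ : ℝ≥0} (hδ : 0 < δ)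
    (σ : ℝ) (u v : ℕ → ℝ) (K : ℕ) :
    charFun (P.map fun ω => ∑ k ∈ Finset.range K,
      (u k * (σ * (B ((k + 1 : ℕ) * δ) ω - B (k * δ) ω)) +
        v k * (X ((k + 1 : ℕ) * δ) ω - X (k * δ) ω))) 1 =
      ∏ k ∈ Finset.range K, Complex.exp (-((u k ^ 2 * σ ^ 2 + v k ^ 2) * δ / 2 : ℝ)) := by
  have hind : IndepFun
      (fun ω => ∑ k ∈ Finset.range K, (u k * σ) * (B ((k + 1 : ℕ) * δ) ω - B (k * δ) ω))
      (fun ω => ∑ k ∈ Finset.range K, v k * (X ((k + 1 : ℕ) * δ) ω - X (k * δ) ω)) P :=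
    hXB.symm.comp
      (φ := fun b : ℝ≥0 → ℝ => ∑ k ∈ Finset.range K, (u k * σ) * (b ((k + 1 : ℕ) * δ) - b (k * δ)))
      (ψ := fun x : ℝ≥0 → ℝ => ∑ k ∈ Finset.range K, v k * (x ((k + 1 : ℕ) * δ) - x (k * δ)))
      (by fun_prop) (by fun_prop)
  simp_rw [Finset.sum_add_distrib, ← mul_assoc]
  rw [hind.charFun_map_fun_add_eq_mul (by fun_prop) (by fun_prop), Pi.mul_apply,
    charFun_sum_increments hBm hB hδ, charFun_sum_increments hXm hX hδ, ← Finset.prod_mul_distrib]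
  refine Finset.prod_congr rfl fun k _ => ?_
  rw [← Complex.exp_add]
  congr 1
  push_cast
  ring

omit [IsProbabilityMeasure P] in
lemma charFun_blocks (hXm : ∀ t, Measurable (X t)) (hX : IsBrownianReal X P)
    {h : ℝ≥0} (hh : 0 < h) {a : ℕ → ℕ} (ha : Monotone a) (ha0 : a 0 = 0) (u v : ℕ → ℝ) (K : ℕ) :
    charFun (P.map fun ω => ∑ k ∈ Finset.range K,
      (u k * blockIncr X p α β γ h ω (a k) (a (k + 1)) +
        v k * (X (a (k + 1) * h) ω - X (a k * h) ω))) 1 =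
      ∏ k ∈ Finset.range K, ∏ i ∈ Finset.Ico (a k) (a (k + 1)),
        charFun ((gaussianReal 0 1).map
          fun x => u k * (weightPoly p α β γ i).eval x + v k * x) √h := by
  set G : ℕ → ℝ → ℝ := fun i x => √h * (u (blockIndex a K i) * (weightPoly p α β γ i).eval x +
    v (blockIndex a K i) * x) with hG
  have hGm : ∀ i, Measurable (G i) := fun i => by simp only [hG]; fun_prop
  have hsum : (fun ω => ∑ k ∈ Finset.range K,
      (u k * blockIncr X p α β γ h ω (a k) (a (k + 1)) +
        v k * (X (a (k + 1) * h) ω - X (a k * h) ω))) =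
      fun ω => ∑ i ∈ Finset.range (a K), G i (normIncr X h i ω) := by
    funext ω
    rw [sum_range_eq_sum_Ico ha ha0]
    refine Finset.sum_congr rfl fun k hk => ?_
    rw [increment_eq_sqrt_mul_sum hh (ha (Nat.le_succ k)), blockIncr, ← mul_assoc, ← mul_assoc,
      Finset.mul_sum, Finset.mul_sum, ← Finset.sum_add_distrib]
    refine Finset.sum_congr rfl fun i hi => ?_
    obtain ⟨h1, h2⟩ := Finset.mem_Ico.1 hi
    simp only [hG]
    rw [blockIndex_eq ha (Finset.mem_range.1 hk).le h1 h2]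
    ring
  rw [hsum, charFun_sum_comp_normIncr hXm hX hh hGm, prod_range_eq_prod_Ico ha ha0]
  refine Finset.prod_congr rfl fun k hk => Finset.prod_congr rfl fun i hi => ?_
  obtain ⟨h1, h2⟩ := Finset.mem_Ico.1 hi
  simp only [hG]
  rw [blockIndex_eq ha (Finset.mem_range.1 hk).le h1 h2,
    charFun_map_mul_comp (f := fun x => u k * (weightPoly p α β γ i).eval x + v k * x)
    (by fun_prop), mul_one]

lemma prod_Ico_alternating {A : Type*} [CommMonoid A] {G : ℕ → A}
    (h0 : ∀ i, Even i → G i = G 0) (h1 : ∀ i, Odd i → G i = G 1) {a b : ℕ} (hab : a ≤ b) :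
    ∏ i ∈ Finset.Ico a b, G i = G 0 ^ ((b + 1) / 2 - (a + 1) / 2) * G 1 ^ (b / 2 - a / 2) := by
  induction b, hab using Nat.le_induction with
  | base => simp
  | succ b hab ih =>
    rw [Finset.prod_Ico_succ_top hab, ih]
    rcases Nat.even_or_odd b with hb | hb
    · obtain ⟨c, rfl⟩ := hb
      rw [h0 _ ⟨c, rfl⟩, show (c + c + 1 + 1) / 2 - (a + 1) / 2 =
        ((c + c + 1) / 2 - (a + 1) / 2) + 1 by lia, show (c + c + 1) / 2 - a / 2 =
        (c + c) / 2 - a / 2 by lia, pow_succ]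
      exact mul_right_comm _ _ _
    · obtain ⟨c, rfl⟩ := hb
      rw [h1 _ ⟨c, rfl⟩, show (2 * c + 1 + 1 + 1) / 2 - (a + 1) / 2 =
        (2 * c + 1 + 1) / 2 - (a + 1) / 2 by lia, show (2 * c + 1 + 1) / 2 - a / 2 =
        ((2 * c + 1) / 2 - a / 2) + 1 by lia, pow_succ, mul_assoc]

lemma tendsto_half_block_mul {h : ℕ → ℝ≥0} (hh : ∀ n, 0 < h n) (hlim : Tendsto h atTop (𝓝 0))
    {δ : ℝ≥0} (k : ℕ) {N : ℕ → ℕ}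
    (hN : ∀ n, |2 * (N n : ℝ) - ((⌊(k + 1 : ℕ) * δ / h n⌋₊ : ℝ) - ⌊k * δ / h n⌋₊)| ≤ 2) :
    Tendsto (fun n => (N n : ℝ) * √(h n) ^ 2) atTop (𝓝 (δ / 2)) := by
  have hlim' : Tendsto (fun n => 2 * (h n : ℝ)) atTop (𝓝 0) := by
    have := (NNReal.tendsto_coe.2 hlim).const_mul 2
    simpa using this
  rw [tendsto_iff_dist_tendsto_zero]
  refine squeeze_zero (fun _ => dist_nonneg) (fun n => ?_) hlim'
  rw [Real.dist_eq, Real.sq_sqrt (h n).coe_nonneg]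
  have hpos : (0 : ℝ) < h n := by exact_mod_cast hh n
  have e1 := floor_div_mul_le (t := k * δ) (hh n)
  have e2 := lt_floor_div_add_one_mul (t := k * δ) (hh n)
  have e3 := floor_div_mul_le (t := (k + 1 : ℕ) * δ) (hh n)
  have e4 := lt_floor_div_add_one_mul (t := (k + 1 : ℕ) * δ) (hh n)
  push_cast at e1 e2 e3 e4
  have e5 := abs_le.1 (hN n)
  push_cast at e5
  rw [abs_le]
  constructor <;> nlinarith

omit [IsProbabilityMeasure P] mΩ in
lemma tendsto_prod_charFun_block (hp : HasCenteredHermiteRankGeTwo p) {h : ℕ → ℝ≥0}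
    (hh : ∀ n, 0 < h n) (hlim : Tendsto h atTop (𝓝 0)) (δ : ℝ≥0) (k : ℕ) (u v : ℝ) :
    Tendsto (fun n => ∏ i ∈ Finset.Ico ⌊k * δ / h n⌋₊ ⌊(k + 1 : ℕ) * δ / h n⌋₊,
      charFun ((gaussianReal 0 1).map
        fun x => u * (weightPoly p α β γ i).eval x + v * x) √(h n)) atTop
      (𝓝 (Complex.exp (-((u ^ 2 * √(limitVar p α β γ) ^ 2 + v ^ 2) * δ / 2 : ℝ)))) := by
  set Y : ℕ → ℝ → ℝ := fun i x => u * (weightPoly p α β γ i).eval x + v * x with hY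
  set c : ℕ → ℝ := fun i => u * alternating α β (i + 1) with hc
  set d : ℕ → ℝ := fun i => u * (γ * (-1) ^ (i + 1)) + v with hd
  have hYeq : ∀ i x, Y i x = c i * (p.eval x - gaussianMean p) + d i * x := fun i x => by
    simp only [hY, hc, hd, eval_weightPoly]; ring
  have hmem : ∀ i, MemLp (Y i) 2 (gaussianReal 0 1) := fun i => by
    refine (memLp_eval_gaussianReal (Polynomial.C u * weightPoly p α β γ i +
      Polynomial.C v * Polynomial.X)).ae_eq (ae_of_all _ fun x => ?_)
    simp [hY]
  have h0 : ∀ i, ∫ x, Y i x ∂(gaussianReal 0 1) = 0 := fun i => by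
    simp_rw [hYeq]
    exact integral_mul_sub_gaussianMean_add _ _
  have h2 : ∀ i, ∫ x, Y i x ^ 2 ∂(gaussianReal 0 1) = c i ^ 2 * gaussianVar p + d i ^ 2 :=
    fun i => by
      simp_rw [hYeq]
      exact integral_mul_sub_gaussianMean_add_sq hp _ _
  have hr : Tendsto (fun n => √(h n : ℝ)) atTop (𝓝 0) := by
    have := (Real.continuous_sqrt.tendsto _).comp (NNReal.tendsto_coe.2 hlim)
    simpa [Function.comp_def] using this
  have hab : ∀ n, ⌊k * δ / h n⌋₊ ≤ ⌊(k + 1 : ℕ) * δ / h n⌋₊ := fun n =>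
    monotone_blockBound (h n) δ (Nat.le_succ k)
  have hprod := fun n => prod_Ico_alternating
    (G := fun i => charFun ((gaussianReal 0 1).map (Y i)) √(h n))
    (fun i hi => by simp only [hY, weightPoly_of_even hi])
    (fun i hi => by simp only [hY, weightPoly_of_odd hi]) (hab n)
  refine Tendsto.congr (fun n => (hprod n).symm) ?_
  have hcast : ∀ {a b N : ℕ}, a ≤ b → 2 * N ≤ b - a + 2 → b - a ≤ 2 * N + 2 →
      |2 * (N : ℝ) - ((b : ℝ) - a)| ≤ 2 := by
    intro a b N h1 h2 h3
    rw [← Nat.cast_sub h1]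
    rw [abs_le]
    have h2' : (2 : ℝ) * N ≤ (b - a : ℕ) + 2 := by exact_mod_cast h2
    have h3' : ((b - a : ℕ) : ℝ) ≤ 2 * N + 2 := by exact_mod_cast h3
    constructor <;> linarith
  have t0 := tendsto_charFun_pow (hmem 0) (h0 0) (h2 0) hr
    (tendsto_half_block_mul hh hlim k (δ := δ)
      (N := fun n => (⌊(k + 1 : ℕ) * δ / h n⌋₊ + 1) / 2 - (⌊k * δ / h n⌋₊ + 1) / 2)
      fun n => hcast (hab n) (by have := hab n; lia) (by have := hab n; lia))
  have t1 := tendsto_charFun_pow (hmem 1) (h0 1) (h2 1) hr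
    (tendsto_half_block_mul hh hlim k (δ := δ)
      (N := fun n => ⌊(k + 1 : ℕ) * δ / h n⌋₊ / 2 - ⌊k * δ / h n⌋₊ / 2)
      fun n => hcast (hab n) (by have := hab n; lia) (by have := hab n; lia))
  have t := t0.mul t1
  rw [← Complex.exp_add] at t
  convert! t using 3
  rw [Real.sq_sqrt (limitVar_nonneg p α β γ)]
  simp only [hc, hd, limitVar, alternating]
  norm_num
  ring

/-- Joint central limit theorem for the block sums and the increments of `X`. -/
theorem tendstoInDistribution_blocks (hXm : ∀ t, Measurable (X t)) (hBm : ∀ t, Measurable (B t))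
    (hX : IsBrownianReal X P) (hB : IsBrownianReal B P)
    (hXB : IndepFun (fun ω t => X t ω) (fun ω t => B t ω) P)
    (hp : HasCenteredHermiteRankGeTwo p) {h : ℕ → ℝ≥0} (hh : ∀ n, 0 < h n)
    (hlim : Tendsto h atTop (𝓝 0)) {δ : ℝ≥0} (hδ : 0 < δ) (K : ℕ) :
    TendstoInDistribution (fun n ω (k : Fin K) =>
      (blockIncr X p α β γ (h n) ω ⌊(k : ℕ) * δ / h n⌋₊ ⌊(k + 1 : ℕ) * δ / h n⌋₊,
        X (⌊(k + 1 : ℕ) * δ / h n⌋₊ * h n) ω - X (⌊(k : ℕ) * δ / h n⌋₊ * h n) ω)) atTop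
      (fun ω (k : Fin K) => (√(limitVar p α β γ) * (B ((k + 1 : ℕ) * δ) ω - B ((k : ℕ) * δ) ω),
        X ((k + 1 : ℕ) * δ) ω - X ((k : ℕ) * δ) ω)) (fun _ => P) P := by
  set σ := √(limitVar p α β γ) with hσ
  set a : ℕ → ℕ → ℕ := fun n k => ⌊k * δ / h n⌋₊ with ha
  set V : ℕ → Ω → EuclideanSpace ℝ (Fin K ⊕ Fin K) := fun n ω => WithLp.toLp 2
    (Sum.elim (fun k => blockIncr X p α β γ (h n) ω (a n k) (a n (k + 1)))
      (fun k => X (a n (k + 1) * h n) ω - X (a n k * h n) ω)) with hV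
  set Z : Ω → EuclideanSpace ℝ (Fin K ⊕ Fin K) := fun ω => WithLp.toLp 2
    (Sum.elim (fun k => σ * (B ((k + 1 : ℕ) * δ) ω - B ((k : ℕ) * δ) ω))
      (fun k => X ((k + 1 : ℕ) * δ) ω - X ((k : ℕ) * δ) ω)) with hZ
  have hVm : ∀ n, Measurable (V n) := fun n => by
    refine (WithLp.measurable_toLp 2 _).comp (measurable_pi_lambda _ ?_)
    rintro (k | k)
    · exact measurable_blockIncr hXm _ _ _
    · exact (hXm _).sub (hXm _)
  have hZm : Measurable Z := by
    refine (WithLp.measurable_toLp 2 _).comp (measurable_pi_lambda _ ?_)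
    rintro (k | k)
    · exact ((hBm _).sub (hBm _)).const_mul _
    · exact (hXm _).sub (hXm _)
  have hchar : ∀ {W : Ω → EuclideanSpace ℝ (Fin K ⊕ Fin K)} (_ : Measurable W)
      (c : EuclideanSpace ℝ (Fin K ⊕ Fin K)),
      charFun (P.map W) c = charFun (P.map fun ω => ∑ k : Fin K,
        (c (Sum.inl k) * W ω (Sum.inl k) + c (Sum.inr k) * W ω (Sum.inr k))) 1 := by
    intro W hW c
    have hm : Measurable fun ω => ∑ k : Fin K,
        (c (Sum.inl k) * W ω (Sum.inl k) + c (Sum.inr k) * W ω (Sum.inr k)) := by fun_prop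
    rw [charFun_apply, charFun_apply_real, integral_map hW.aemeasurable (by fun_prop),
      integral_map hm.aemeasurable (by fun_prop)]
    refine integral_congr_ae (ae_of_all _ fun ω => ?_)
    simp only [PiLp.inner_apply, Fintype.sum_sum_type, ← Finset.sum_add_distrib]
    simp
  have hconv : TendstoInDistribution V atTop Z (fun _ => P) P := by
    refine ⟨fun n => (hVm n).aemeasurable, hZm.aemeasurable,
      ProbabilityMeasure.tendsto_iff_tendsto_charFun.2 fun c => ?_⟩
    simp only [ProbabilityMeasure.coe_mk]
    set u : ℕ → ℝ := fun k => if hk : k < K then c (Sum.inl ⟨k, hk⟩) else 0 with hu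
    set v : ℕ → ℝ := fun k => if hk : k < K then c (Sum.inr ⟨k, hk⟩) else 0 with hv
    have huk : ∀ k : Fin K, c (Sum.inl k) = u k := fun k => by simp [hu]
    have hvk : ∀ k : Fin K, c (Sum.inr k) = v k := fun k => by simp [hv]
    have e1 : ∀ n, charFun (P.map (V n)) c = ∏ k ∈ Finset.range K,
        ∏ i ∈ Finset.Ico (a n k) (a n (k + 1)), charFun ((gaussianReal 0 1).map
          fun x => u k * (weightPoly p α β γ i).eval x + v k * x) √(h n) := by
      intro n
      rw [hchar (hVm n), ← charFun_blocks hXm hX (hh n) (monotone_blockBound (h n) δ)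
        (by simp) u v K]
      congr 2
      funext ω
      rw [Finset.sum_range]
      refine Finset.sum_congr rfl fun k _ => ?_
      rw [huk, hvk]
      rfl
    have e2 : charFun (P.map Z) c = ∏ k ∈ Finset.range K,
        Complex.exp (-((u k ^ 2 * σ ^ 2 + v k ^ 2) * δ / 2 : ℝ)) := by
      rw [hchar hZm, ← charFun_limit_increments hXm hBm hX hB hXB hδ]
      congr 2
      funext ω
      rw [Finset.sum_range]
      refine Finset.sum_congr rfl fun k _ => ?_
      rw [huk, hvk]
      rfl
    simp_rw [e1]
    rw [e2]
    exact tendsto_finsetProd _ fun k _ => tendsto_prod_charFun_block hp hh hlim δ k (u k) (v k)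
  have hg : Continuous fun (x : EuclideanSpace ℝ (Fin K ⊕ Fin K)) (k : Fin K) =>
      (x (Sum.inl k), x (Sum.inr k)) := by fun_prop
  exact hconv.continuous_comp hg

end WeightedVariation

namespace WeightedVariation

variable {Ω : Type*} {mΩ : MeasurableSpace Ω} {P : Measure Ω} [IsProbabilityMeasure P]
  {X B : ℝ≥0 → Ω → ℝ} {p : Polynomial ℝ} {α β γ : ℝ} {f : ℝ → ℝ} {L M : ℝ≥0}

/-- The discrete integral of `f` along the path with increments `(w k).2`, against the increments
`(w k).1`, together with the end point of the path. -/
def discretePath (f : ℝ → ℝ) (w : ℕ → ℝ × ℝ) (m : ℕ) : ℝ × ℝ :=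
  (∑ k ∈ Finset.range m, f (∑ l ∈ Finset.range k, (w l).2) * (w k).1,
    ∑ k ∈ Finset.range m, (w k).2)

lemma discretePath_congr {w w' : ℕ → ℝ × ℝ} {m : ℕ} (h : ∀ k < m, w k = w' k) :
    discretePath f w m = discretePath f w' m := by
  have h2 : ∀ k ≤ m, ∑ l ∈ Finset.range k, (w l).2 = ∑ l ∈ Finset.range k, (w' l).2 :=
    fun k hk => Finset.sum_congr rfl fun l hl => by
      rw [h l ((Finset.mem_range.1 hl).trans_le hk)]
  refine Prod.ext ?_ (h2 m le_rfl)
  simp only [discretePath]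
  refine Finset.sum_congr rfl fun k hk => ?_
  rw [h2 k (Finset.mem_range.1 hk).le, h k (Finset.mem_range.1 hk)]

lemma discretePath_sub {u y : ℕ → ℝ} (hy : y 0 = 0) (m : ℕ) :
    discretePath f (fun k => (u k, y (k + 1) - y k)) m =
      (∑ k ∈ Finset.range m, f (y k) * u k, y m) := by
  have h : ∀ k, ∑ l ∈ Finset.range k, (y (l + 1) - y l) = y k := fun k => by
    rw [Finset.sum_range_sub, hy, sub_zero]
  simp only [discretePath, h]

/-- Extension by zero of a finite sequence. -/
def extendZero {K : ℕ} (v : Fin K → ℝ × ℝ) (k : ℕ) : ℝ × ℝ := if hk : k < K then v ⟨k, hk⟩ else 0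

lemma continuous_discretePath_extendZero (hf : Continuous f) (K m : ℕ) :
    Continuous fun v : Fin K → ℝ × ℝ => discretePath f (extendZero v) m := by
  have h : ∀ k, Continuous fun v : Fin K → ℝ × ℝ => extendZero v k := fun k => by
    unfold extendZero
    split_ifs <;> fun_prop
  unfold discretePath
  fun_prop

lemma discretePath_extendZero_sub {u y : ℕ → ℝ} (hy : y 0 = 0) {m K : ℕ} (hm : m ≤ K) :
    discretePath f (extendZero fun k : Fin K => (u k, y (k + 1) - y k)) m =
      (∑ k ∈ Finset.range m, f (y k) * u k, y m) := by
  rw [← discretePath_sub hy]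
  exact discretePath_congr fun k hk => by simp [extendZero, hk.trans_le hm]

lemma gridProcess_integral (hXm : ∀ t, Measurable (X t)) (hBm : ∀ t, Measurable (B t))
    (hX : IsBrownianReal X P) (hf : LipschitzWith L f) {δ : ℝ≥0} (hδ : 0 < δ) (t : ℝ≥0) (ω : Ω) :
    (gridProcess hXm hBm hX hf δ ⌊t / δ⌋₊).integral B t ω =
      ∑ k ∈ Finset.range ⌊t / δ⌋₊, f (X (k * δ) ω) * (B ((k + 1 : ℕ) * δ) ω - B (k * δ) ω) := by
  have hle : ∀ k ≤ ⌊t / δ⌋₊, (k : ℝ≥0) * δ ≤ t := fun k hk => by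
    rw [← le_div_iff₀ hδ]
    exact (Nat.le_floor_iff zero_le).1 hk
  refine Finset.sum_congr rfl fun k hk => ?_
  simp only [gridProcess]
  rw [min_eq_left (hle k (Finset.mem_range.1 hk).le), min_eq_left (hle (k + 1) (Finset.mem_range.1 hk))]

theorem tendstoInDistribution_blockSum (hXm : ∀ t, Measurable (X t))
    (hBm : ∀ t, Measurable (B t)) (hX : IsBrownianReal X P) (hB : IsBrownianReal B P)
    (hXB : IndepFun (fun ω t => X t ω) (fun ω t => B t ω) P)
    (hp : HasCenteredHermiteRankGeTwo p) (hf : LipschitzWith L f) {h : ℕ → ℝ≥0}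
    (hh : ∀ n, 0 < h n) (hlim : Tendsto h atTop (𝓝 0)) {δ : ℝ≥0} (hδ : 0 < δ) (I : Finset ℝ≥0) :
    TendstoInDistribution (fun n ω (t : I) => (blockSum X p α β γ f (h n) δ t ω,
        X (⌊(⌊t / δ⌋₊ : ℕ) * δ / h n⌋₊ * h n) ω)) atTop
      (fun ω (t : I) => (√(limitVar p α β γ) *
        (gridProcess hXm hBm hX hf δ ⌊t / δ⌋₊).integral B t ω, X (⌊t / δ⌋₊ * δ) ω))
      (fun _ => P) P := by
  set K := I.sup fun t => ⌊t / δ⌋₊ with hK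
  have hKt : ∀ t : I, ⌊t / δ⌋₊ ≤ K := fun t => Finset.le_sup (f := fun t => ⌊t / δ⌋₊) t.2
  have hg : Continuous fun (v : Fin K → ℝ × ℝ) (t : I) =>
      discretePath f (extendZero v) ⌊t / δ⌋₊ :=
    continuous_pi fun t => continuous_discretePath_extendZero hf.continuous K _
  refine ((tendstoInDistribution_blocks (p := p) (α := α) (β := β) (γ := γ) hXm hBm hX hB hXB hp
    hh hlim hδ K).continuous_comp hg).congr (fun n => ?_) ?_
  · filter_upwards [hX.eval_zero_ae_eq_zero] with ω hω
    funext t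
    exact discretePath_extendZero_sub (y := fun k => X (⌊k * δ / h n⌋₊ * h n) ω)
      (u := fun k => blockIncr X p α β γ (h n) ω ⌊k * δ / h n⌋₊ ⌊(k + 1 : ℕ) * δ / h n⌋₊)
      (by simpa using hω) (hKt t)
  · filter_upwards [hX.eval_zero_ae_eq_zero] with ω hω
    funext t
    refine (discretePath_extendZero_sub (y := fun k => X (k * δ) ω)
      (u := fun k => √(limitVar p α β γ) * (B ((k + 1 : ℕ) * δ) ω - B (k * δ) ω))
      (by simpa using hω) (hKt t)).trans ?_
    rw [gridProcess_integral hXm hBm hX hf hδ, Finset.mul_sum]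
    congr 1
    exact Finset.sum_congr rfl fun k _ => mul_left_comm _ _ _

omit [IsProbabilityMeasure P] in
lemma lintegral_enorm_pi_prod_sub_le {ι : Type*} [Fintype ι] {Y Y' : Ω → ι → ℝ × ℝ}
    (hY : ∀ t, AEMeasurable (fun ω => Y ω t) P) (hY' : ∀ t, AEMeasurable (fun ω => Y' ω t) P)
    {a b : ι → ℝ} (ha : ∀ t, 0 ≤ a t) (hb : ∀ t, 0 ≤ b t)
    (h1 : ∀ t, eLpNorm (fun ω => (Y ω t).1 - (Y' ω t).1) 1 P ≤ ENNReal.ofReal (a t))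
    (h2 : ∀ t, eLpNorm (fun ω => (Y ω t).2 - (Y' ω t).2) 1 P ≤ ENNReal.ofReal (b t)) :
    ∫⁻ ω, ‖Y ω - Y' ω‖ₑ ∂P ≤ ENNReal.ofReal (∑ t, (a t + b t)) := by
  have hle : ∀ ω, ‖Y ω - Y' ω‖ₑ ≤
      ∑ t, (‖(Y ω t).1 - (Y' ω t).1‖ₑ + ‖(Y ω t).2 - (Y' ω t).2‖ₑ) := fun ω => by
    have : ‖Y ω - Y' ω‖ ≤ ∑ t, (‖(Y ω t).1 - (Y' ω t).1‖ + ‖(Y ω t).2 - (Y' ω t).2‖) := by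
      refine (pi_norm_le_iff_of_nonneg (Finset.sum_nonneg fun t _ => by positivity)).2 fun t => ?_
      refine le_trans ?_ (Finset.single_le_sum
        (f := fun t => ‖(Y ω t).1 - (Y' ω t).1‖ + ‖(Y ω t).2 - (Y' ω t).2‖)
        (fun t _ => by positivity) (Finset.mem_univ t))
      rw [Prod.norm_def]
      exact max_le_add_of_nonneg (norm_nonneg _) (norm_nonneg _)
    simp_rw [← ofReal_norm]
    simp_rw [← ENNReal.ofReal_add (norm_nonneg _) (norm_nonneg _)]
    rw [← ENNReal.ofReal_sum_of_nonneg fun t _ => by positivity]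
    exact ENNReal.ofReal_le_ofReal this
  have hm1 : ∀ t, AEMeasurable (fun ω => ‖(Y ω t).1 - (Y' ω t).1‖ₑ) P := fun t =>
    ((hY t).fst.sub (hY' t).fst).enorm
  have hm2 : ∀ t, AEMeasurable (fun ω => ‖(Y ω t).2 - (Y' ω t).2‖ₑ) P := fun t =>
    ((hY t).snd.sub (hY' t).snd).enorm
  refine (lintegral_mono hle).trans ?_
  have hm : ∀ t ∈ (Finset.univ : Finset ι), AEMeasurable
      (fun ω => ‖(Y ω t).1 - (Y' ω t).1‖ₑ + ‖(Y ω t).2 - (Y' ω t).2‖ₑ) P :=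
    fun t _ => (hm1 t).add (hm2 t)
  rw [lintegral_finsetSum' _ hm,
    ENNReal.ofReal_sum_of_nonneg fun t _ => add_nonneg (ha t) (hb t)]
  refine Finset.sum_le_sum fun t _ => ?_
  rw [lintegral_add_left' (hm1 t), ENNReal.ofReal_add (ha t) (hb t)]
  have e1 := h1 t
  have e2 := h2 t
  rw [eLpNorm_one_eq_lintegral_enorm] at e1 e2
  exact add_le_add e1 e2

lemma eLpNorm_one_increment_le (hX : IsBrownianReal X P) {s t : ℝ≥0} {c : ℝ}
    (hc : |(t : ℝ) - s| ≤ c) : eLpNorm (fun ω => X t ω - X s ω) 1 P ≤ ENNReal.ofReal √c :=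
  eLpNorm_one_le_of_integral_sq_le (memLp_increment hX s t)
    ((integral_increment_sq hX s t).trans_le hc)

lemma eLpNorm_one_ito_sub_le (hXm : ∀ t, Measurable (X t)) (hBm : ∀ t, Measurable (B t))
    (hX : IsBrownianReal X P) (hB : IsBrownianReal B P)
    (hXB : IndepFun (fun ω t => X t ω) (fun ω t => B t ω) P) (hf : LipschitzWith L f)
    {t : ℝ≥0} {J : Ω → ℝ}
    (hJ : IsItoIntegral (jointFiltration X B hXm hBm) P B (fun s ω => f (X s ω)) t J)
    {δ : ℝ≥0} (hδ : 0 < δ) :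
    eLpNorm (fun ω => (gridProcess hXm hBm hX hf δ ⌊t / δ⌋₊).integral B t ω - J ω) 1 P ≤
      ENNReal.ofReal (√(L ^ 2 * t + (2 * f 0 ^ 2 + 2 * L ^ 2 * t)) * √δ) := by
  set ψ := gridProcess hXm hBm hX hf δ ⌊t / δ⌋₊
  have hm : AEStronglyMeasurable (fun ω => ψ.integral B t ω - J ω) P :=
    (SimpleProcess.memLp_integral_sub hXm hBm hB hXB ψ t).1.sub hJ.1
  refine (eLpNorm_le_eLpNorm_of_exponent_le one_le_two hm).trans ?_
  have h2 := (eLpNorm_integral_sub_ito_sq_le hXm hBm hX hB hXB hf hJ ψ).trans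
    (lintegral_lintegral_gridProcess_sub_sq_le hXm hBm hX hf hδ rfl)
  rw [← Real.sqrt_mul (by positivity)]
  refine (ENNReal.pow_le_pow_left_iff two_ne_zero).1 (h2.trans_eq ?_)
  rw [← ENNReal.ofReal_pow (Real.sqrt_nonneg _), Real.sq_sqrt (by positivity)]

theorem tendstoFDD_meshSum (hXm : ∀ t, Measurable (X t)) (hBm : ∀ t, Measurable (B t))
    (hX : IsBrownianReal X P) (hB : IsBrownianReal B P)
    (hXB : IndepFun (fun ω t => X t ω) (fun ω t => B t ω) P)
    (hp : HasCenteredHermiteRankGeTwo p) (hf : LipschitzWith L f) (hfd : Differentiable ℝ f)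
    (hf' : LipschitzWith M (deriv f)) {h : ℕ → ℝ≥0} (hh : ∀ n, 0 < h n)
    (hlim : Tendsto h atTop (𝓝 0)) {S : ℝ≥0 → Ω → ℝ}
    (hS : ∀ t, IsItoIntegral (jointFiltration X B hXm hBm) P B (fun s ω => f (X s ω)) t (S t)) :
    TendstoFDD P (fun n t ω => (meshSum X p α β γ f (h n) t ω, X t ω))
      (fun t ω => (√(limitVar p α β γ) * S t ω, X t ω)) := by
  intro I
  set σ := √(limitVar p α β γ) with hσ
  have hSm : ∀ t, AEMeasurable (S t) P := fun t => (hS t).1.aemeasurable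
  choose C hC0 hC using fun t : ℝ≥0 => eLpNorm_meshSum_sub_blockSum_le (α := α) (β := β)
    (γ := γ) hXm hX t hp hf hfd hf'
  set D : ℝ≥0 → ℝ := fun t => σ * √(L ^ 2 * t + (2 * f 0 ^ 2 + 2 * L ^ 2 * t)) with hD
  have hD0 : ∀ t, 0 ≤ D t := fun t => by positivity
  refine tendstoInDistribution_of_forall_approx (fun n => aemeasurable_pi_lambda _ fun t =>
    ((measurable_meshSum hXm hf.continuous _ _).prodMk (hXm t)).aemeasurable)
    (aemeasurable_pi_lambda _ fun t => ((hSm t).const_mul _).prodMk (hXm t).aemeasurable)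
    fun ε hε => ?_
  obtain ⟨δ, hδ0, hδ1, hδε⟩ : ∃ δ : ℝ≥0, 0 < δ ∧ δ ≤ 1 ∧
      (∑ t : I, ((C t + D t) + 2)) * √δ ≤ ε := by
    have ht : Tendsto (fun δ : ℝ≥0 => (∑ t : I, ((C t + D t) + 2)) * √(δ : ℝ)) (𝓝[>] 0) (𝓝 0) := by
      have : Continuous fun δ : ℝ≥0 => (∑ t : I, ((C t + D t) + 2)) * √(δ : ℝ) := by fun_prop
      simpa using (this.tendsto 0).mono_left nhdsWithin_le_nhds
    obtain ⟨δ, h1, h2, h3⟩ := ((ht.eventually (ge_mem_nhds hε)).and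
      ((Ioc_mem_nhdsGT (zero_lt_one (α := ℝ≥0))))).exists
    exact ⟨δ, h2, h3, h1⟩
  have hfloor : ∀ t : ℝ≥0, |(t : ℝ) - (⌊t / δ⌋₊ * δ : ℝ≥0)| ≤ δ := fun t => by
    have e1 := floor_div_mul_le (t := t) hδ0
    have e2 := lt_floor_div_add_one_mul (t := t) hδ0
    push_cast
    rw [abs_le]
    constructor <;> nlinarith [δ.coe_nonneg]
  refine ⟨_, _, tendstoInDistribution_blockSum (p := p) (α := α) (β := β) (γ := γ) hXm hBm hX hB
    hXB hp hf hh hlim hδ0 I, ?_, ?_⟩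
  · filter_upwards [hlim.eventually (ge_mem_nhds hδ0)] with n hn
    refine le_trans (lintegral_enorm_pi_prod_sub_le (a := fun t : I => C t * √δ)
      (b := fun _ => √(2 * δ)) (fun t => ?_) (fun t => ?_)
      (fun t => mul_nonneg (hC0 t) (Real.sqrt_nonneg _)) (fun t => Real.sqrt_nonneg _) ?_ ?_) ?_
    · exact ((measurable_meshSum hXm hf.continuous _ _).prodMk (hXm t)).aemeasurable
    · exact ((measurable_blockSum hXm hf.continuous _ _ _).prodMk (hXm _)).aemeasurable
    · intro t
      exact hC t δ (h n) (hh n) hn hδ1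
    · intro t
      refine eLpNorm_one_increment_le hX ?_
      have e1 := floor_div_mul_le (t := ⌊t / δ⌋₊ * δ) (hh n)
      have e2 := lt_floor_div_add_one_mul (t := ⌊t / δ⌋₊ * δ) (hh n)
      have e3 := abs_le.1 (hfloor t)
      have e4 : (h n : ℝ) ≤ δ := by exact_mod_cast hn
      push_cast at e1 e2 e3 ⊢
      rw [abs_le]
      constructor <;> nlinarith
    · refine ENNReal.ofReal_le_ofReal (le_trans ?_ hδε)
      rw [Finset.sum_mul]
      refine Finset.sum_le_sum fun t _ => ?_
      have : √(2 * (δ : ℝ)) ≤ 2 * √δ := by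
        rw [Real.sqrt_mul zero_le_two]
        gcongr
        exact Real.sqrt_le_iff.2 (by norm_num)
      nlinarith [mul_nonneg (hD0 t) (Real.sqrt_nonneg δ)]
  · refine le_trans (lintegral_enorm_pi_prod_sub_le (a := fun t : I => D t * √δ)
      (b := fun _ => √δ) (fun t => ?_) (fun t => ?_)
      (fun t => mul_nonneg (hD0 t) (Real.sqrt_nonneg _)) (fun t => Real.sqrt_nonneg _) ?_ ?_) ?_
    · exact ((SimpleProcess.memLp_integral_sub hXm hBm hB hXB _ _).1.aemeasurable.const_mul
        _).prodMk (hXm _).aemeasurable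
    · exact ((hSm t).const_mul _).prodMk (hXm t).aemeasurable
    · intro t
      simp only [← hσ, ← mul_sub]
      refine (eLpNorm_const_smul σ (fun ω => (gridProcess hXm hBm hX hf δ ⌊t / δ⌋₊).integral B t ω -
        S t ω) 1 P).trans_le ?_
      rw [hD, mul_assoc, ENNReal.ofReal_mul (Real.sqrt_nonneg _), Real.enorm_of_nonneg
        (Real.sqrt_nonneg _)]
      gcongr
      exact eLpNorm_one_ito_sub_le hXm hBm hX hB hXB hf (hS t) hδ0
    · intro t
      refine eLpNorm_one_increment_le hX ?_
      rw [abs_sub_comm]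
      exact hfloor t
    · refine ENNReal.ofReal_le_ofReal (le_trans ?_ hδε)
      rw [Finset.sum_mul]
      refine Finset.sum_le_sum fun t _ => ?_
      nlinarith [mul_nonneg (hC0 t) (Real.sqrt_nonneg δ), Real.sqrt_nonneg δ]

/-- The mesh `2^{-n/2}`. -/
noncomputable def dyadicMesh (n : ℕ) : ℝ≥0 := (2 : ℝ≥0) ^ (-(n : ℝ) / 2)

lemma dyadicMesh_pos (n : ℕ) : 0 < dyadicMesh n := NNReal.rpow_pos two_pos

lemma tendsto_dyadicMesh : Tendsto dyadicMesh atTop (𝓝 0) := by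
  rw [← NNReal.tendsto_coe]
  have h : ∀ n : ℕ, (dyadicMesh n : ℝ) = ((2 : ℝ) ^ (-(1 / 2 : ℝ))) ^ n := fun n => by
    rw [dyadicMesh, NNReal.coe_rpow, ← Real.rpow_natCast, ← Real.rpow_mul (by norm_num)]
    norm_num
    ring_nf
  simp_rw [h]
  exact tendsto_pow_atTop_nhds_zero_of_lt_one (by positivity)
    (Real.rpow_lt_one_of_one_lt_of_neg (by norm_num) (by norm_num))

lemma sqrt_dyadicMesh (n : ℕ) : √(dyadicMesh n : ℝ) = (2 : ℝ) ^ (-(n : ℝ) / 4) := by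
  rw [dyadicMesh, NNReal.coe_rpow, Real.sqrt_eq_rpow, ← Real.rpow_mul (by norm_num)]
  norm_num
  ring_nf

lemma increment_succ (X : ℝ≥0 → Ω → ℝ) (n i : ℕ) (ω : Ω) :
    increment X n (i + 1) ω = normIncr X (dyadicMesh n) i ω := by
  rw [normIncr, sqrt_dyadicMesh, neg_div, Real.rpow_neg (by norm_num), div_inv_eq_mul, increment,
    rescaled, rescaled, Nat.add_sub_cancel, ← mul_sub, mul_comm]
  rfl

lemma weightedSum_eq_meshSum (X : ℝ≥0 → Ω → ℝ) (n : ℕ) (t : ℝ≥0) (ω : Ω) :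
    weightedSum X p α β γ f n t ω = meshSum X p α β γ f (dyadicMesh n) t ω := by
  have hN : ⌊(2 : ℝ) ^ ((n : ℝ) / 2) * (t : ℝ)⌋₊ = ⌊t / dyadicMesh n⌋₊ := by
    refine Eq.trans ?_ (Nonneg.nat_floor_coe _)
    congr 1
    change _ = ((t / dyadicMesh n : ℝ≥0) : ℝ)
    rw [NNReal.coe_div, dyadicMesh, NNReal.coe_rpow, neg_div, Real.rpow_neg (by norm_num),
      NNReal.coe_ofNat, div_inv_eq_mul, mul_comm]
  rw [weightedSum, meshSum, hN, sqrt_dyadicMesh, Finset.range_eq_Ico,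
    ← Finset.Ico_add_one_right_eq_Icc, Finset.sum_Ico_eq_sum_range,
    Nat.add_sub_cancel, ← Finset.range_eq_Ico]
  congr 1
  refine Finset.sum_congr rfl fun i _ => ?_
  rw [add_comm 1 i, increment_succ, eval_weightPoly, Nat.add_sub_cancel]
  rfl

end WeightedVariation

theorem mainTheorem4 {Ω : Type*} {mΩ : MeasurableSpace Ω} (P : Measure Ω) [IsProbabilityMeasure P]
    (X B : ℝ≥0 → Ω → ℝ)
    (hXm : ∀ t, Measurable (X t)) (hBm : ∀ t, Measurable (B t))
    (hX : IsBrownianReal X P) (hB : IsBrownianReal B P)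
    (hXB : IndepFun (fun ω t => X t ω) (fun ω t => B t ω) P)
    (p : Polynomial ℝ) (hp : WeightedVariation.HasCenteredHermiteRankGeTwo p)
    (α β γ : ℝ)
    (f : ℝ → ℝ) (hf : ContDiff ℝ 2 f)
    (hf₁ : ∃ C : ℝ, ∀ x, |deriv f x| ≤ C)
    (hf₂ : ∃ C : ℝ, ∀ x, |deriv (deriv f) x| ≤ C) :
    (∃ S : ℝ≥0 → Ω → ℝ, ∀ t, WeightedVariation.IsItoIntegral
      (WeightedVariation.jointFiltration X B hXm hBm) P B (fun s ω => f (X s ω)) t (S t)) ∧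
    ∀ S : ℝ≥0 → Ω → ℝ,
      (∀ t, WeightedVariation.IsItoIntegral
        (WeightedVariation.jointFiltration X B hXm hBm) P B (fun s ω => f (X s ω)) t (S t)) →
      WeightedVariation.TendstoFDD P
        (fun n t ω => (WeightedVariation.weightedSum X p α β γ f n t ω, X t ω))
        (fun t ω =>
          (√(γ ^ 2 + (α ^ 2 + β ^ 2) / 2 * WeightedVariation.gaussianVar p) * S t ω,
            X t ω)) := by
  have hlip : ∀ {g : ℝ → ℝ}, Differentiable ℝ g → (∃ C : ℝ, ∀ x, |deriv g x| ≤ C) →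
      ∃ L : ℝ≥0, LipschitzWith L g := fun hg ⟨C, hC⟩ =>
    ⟨C.toNNReal, lipschitzWith_of_nnnorm_deriv_le hg fun x => by
      rw [← NNReal.coe_le_coe]
      exact (hC x).trans (Real.le_coe_toNNReal C)⟩
  have hfd : Differentiable ℝ f := hf.differentiable (by norm_num)
  have hf' : ContDiff ℝ 1 (deriv f) := (contDiff_succ_iff_deriv (n := 1)).1 hf |>.2.2
  obtain ⟨L, hL⟩ := hlip hfd hf₁
  obtain ⟨M, hM⟩ := hlip (hf'.differentiable (by norm_num)) hf₂
  refine ⟨?_, fun S hS => ?_⟩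
  · choose S hS using WeightedVariation.exists_isItoIntegral hXm hBm hX hB hXB hL
    exact ⟨S, hS⟩
  · simp_rw [WeightedVariation.weightedSum_eq_meshSum]
    exact WeightedVariation.tendstoFDD_meshSum hXm hBm hX hB hXB hp hL hfd hM
      WeightedVariation.dyadicMesh_pos WeightedVariation.tendsto_dyadicMesh hS
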